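/- **Language.** The finite types are generated from the type $0$ (natural numbers) by $\sigma,\tau\mapsto(\sigma\to\tau)$; put $1\equiv 0\to 0$ and $n+1\equiv n\to 0$, and let a superscript denote the type. The language $\mathsf{L}_\omega$ has variables of every finite type; the constants $0,1$ of type $0$, $+,\times$ of type $0\to(0\to 0)$, the combinators $\Pi_{\sigma,\tau}:\sigma\to\tau\to\sigma$ and $\Sigma_{\rho,\sigma,\tau}:(\rho\to\sigma\to\tau)\to(\rho\to\sigma)\to\rho\to\tau$, and the recursors $\mathbf{R}_\sigma:(\sigma\to\sigma)\to\sigma\to 0\to\sigma$; and the relations $=_0$ and $<_0$ between type $0$ terms. For $\tau=\tau_1\to\dots\to\tau_k\to 0$, $x=_\tau y$ abbreviates $(\forall z_1^{\tau_1},\dots,z_k^{\tau_k})(xz_1\cdots z_k=_0yz_1\cdots z_k)$, and $x\leq_\tau 1$ abbreviates $(\forall z_1^{\tau_1},\dots,z_k^{\tau_k})(xz_1\cdots z_k\leq_0 1)$. A formula is quantifier-free if it has no quantifiers (variables of any type are allowed). For types $\sigma,\tau$, $\mathsf{QF\text{-}AC}^{\sigma,\tau}$ is the schema $$(\forall x^\sigma)(\exists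 y^\tau)A(x,y)\to(\exists Y^{\sigma\to\tau})(\forall x^\sigma)A(x,Y(x))\qquad(A\text{ quantifier-free, possibly with parameters}).$$ **Base theory.** $\mathsf{RCA}_0^\omega$ is the theory in classical many-sorted predicate logic over $\mathsf{L}_\omega$ with the axioms: $0,1,<_0,+,\times$ form an ordered semi-ring with equality $=_0$; $\Pi_{\sigma,\tau}xy=_\sigma x$ and $\Sigma_{\rho,\sigma,\tau}xyz=_\tau xz(yz)$; $\mathbf{R}_0(f,m,0)=_0m$ and $\mathbf{R}_0(f,m,n+1)=_0f(\mathbf{R}_0(f,m,n))$; extensionality $(\forall x^\rho,y^\rho,\varphi^{\rho\to\tau})[x=_\rho y\to\varphi(x)=_\tau\varphi(y)]$ for all $\rho,\tau$; induction for quantifier-free formulas; and $\mathsf{QF\text{-}AC}^{1,0}$. **Principles.** Write $f\in C$ for $f^1\leq_1 1$, and $\overline{f}N=\overline{g}N$ for $(\forall i<N)(f(i)=g(i))$; inside terms, $\overline{g}n$ is the code of the finite sequence $\langle g(0),\dots,g(n-1)\rangle$ (with code $0$ for the empty sequence and code $(c+a)^2+c+1$ for the sequence with code $c$ followed by $a$).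 Write $Y^2\in\mathsf{cont}$ for $(\forall f^1)(\exists N^0)(\forall g^1)(\overline{f}N=\overline{g}N\to Y(f)=Y(g))$. Consider the sentences - $\mathsf{MUC}$: $(\exists\Omega^3)(\forall Y^2)(\forall f,g\in C)(\overline{f}\,\Omega(Y)=\overline{g}\,\Omega(Y)\to Y(f)=Y(g))$; - $\mathsf{FF}$: $(\exists\Phi^3)(\forall Y^2\in\mathsf{cont})(\forall f,g\in C)(\overline{f}\,\Phi(Y)=\overline{g}\,\Phi(Y)\to Y(f)=Y(g))$; - $(\exists^2)$: $(\exists\varphi^2\leq_2 1)(\forall f^1)[(\exists n^0)(f(n)=0)\leftrightarrow\varphi(f)=0]$; - $(S^2)$: $(\exists S^2\leq_2 1)(\forall f^1)[(\exists g^1)(\forall n^0)(f(\overline{g}n)=0)\leftrightarrow S(f)=0]$; - $(\exists^3)$: $(\exists E^3\leq_3 1)(\forall Y^2)[(\exists f^1)(Y(f)=0)\leftrightarrow E(Y)=0]$; - $(Z^3)$: $(\exists Z^3)(\forall Y^2)[Z(Y)=0\leftrightarrow Y\in\mathsf{cont}]$. **Corollary.** The system $\mathsf{RCA}_0^\omega+\mathsf{QF\text{-}AC}^{2,0}$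 proves $$\mathsf{MUC}\leftrightarrow[\mathsf{FF}\wedge\neg(\exists^2)]\leftrightarrow[\mathsf{FF}\wedge(Z^3)\wedge\neg(S^2)]\leftrightarrow[\mathsf{FF}\wedge(Z^3)\wedge\neg(\exists^3)],$$ that is, it proves each of the three displayed equivalences. -/

import Mathlib

namespace HORM

/-! ## The language of higher-order arithmetic -/

/-- The finite types: the type `nat` (written `0` on paper) of natural numbers, and `σ → τ`. -/
inductive Ty : Type
  | nat : Ty
  | arr : Ty → Ty → Ty

/-- The pure types `1 = 0 → 0`, `2 = 1 → 0`, `3 = 2 → 0`. -/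
abbrev Ty.one : Ty := Ty.arr Ty.nat Ty.nat
abbrev Ty.two : Ty := Ty.arr Ty.one Ty.nat
abbrev Ty.three : Ty := Ty.arr Ty.two Ty.nat

/-- Contexts: the types of the variables that may occur free, the most recently bound first. -/
abbrev Ctx : Type := List Ty

/-- Typed variables (de Bruijn indices): `Var Γ σ` are the variables of type `σ` in `Γ`. -/
inductive Var : Ctx → Ty → Type
  | here {Γ : Ctx} {σ : Ty} : Var (σ :: Γ) σ
  | there {Γ : Ctx} {σ τ : Ty} (x : Var Γ σ) : Var (τ :: Γ) σ

/-- The constants: `0`, `1`, `+`, `×`, the combinators `Π` and `Σ`, and the recursors `R_σ`. -/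
inductive Const : Ty → Type
  | zero : Const Ty.nat
  | one : Const Ty.nat
  | add : Const (Ty.arr Ty.nat (Ty.arr Ty.nat Ty.nat))
  | mul : Const (Ty.arr Ty.nat (Ty.arr Ty.nat Ty.nat))
  | combPi (σ τ : Ty) : Const (Ty.arr σ (Ty.arr τ σ))
  | combSigma (ρ σ τ : Ty) :
      Const (Ty.arr (Ty.arr ρ (Ty.arr σ τ)) (Ty.arr (Ty.arr ρ σ) (Ty.arr ρ τ)))
  | recursor (σ : Ty) :
      Const (Ty.arr (Ty.arr σ σ) (Ty.arr σ (Ty.arr Ty.nat σ)))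

/-- Terms of type `σ` with free variables in `Γ`. -/
inductive Term : Ctx → Ty → Type
  | var {Γ : Ctx} {σ : Ty} (x : Var Γ σ) : Term Γ σ
  | const {Γ : Ctx} {σ : Ty} (c : Const σ) : Term Γ σ
  | app {Γ : Ctx} {σ τ : Ty} (s : Term Γ (Ty.arr σ τ)) (t : Term Γ σ) : Term Γ τ

/-- Formulas with free variables in `Γ`. The prime formulas are `s =₀ t` and `s <₀ t`;
the logic is classical, so that `⊥`, `→` and `∀` suffice as primitives. -/
inductive Formula : Ctx → Type
  | eq {Γ : Ctx} (s t : Term Γ Ty.nat) : Formula Γ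
  | lt {Γ : Ctx} (s t : Term Γ Ty.nat) : Formula Γ
  | falsum {Γ : Ctx} : Formula Γ
  | imp {Γ : Ctx} (A B : Formula Γ) : Formula Γ
  | all {Γ : Ctx} (σ : Ty) (A : Formula (σ :: Γ)) : Formula Γ

/-! ## Renaming and substitution -/

def Ren (Γ Δ : Ctx) : Type := ∀ σ : Ty, Var Γ σ → Var Δ σ

def Ren.lift {Γ Δ : Ctx} (r : Ren Γ Δ) (τ : Ty) : Ren (τ :: Γ) (τ :: Δ)
  | _, Var.here => Var.here
  | _, Var.there x => Var.there (r _ x)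

def Term.rename {Γ Δ : Ctx} (r : Ren Γ Δ) : {σ : Ty} → Term Γ σ → Term Δ σ
  | _, Term.var x => Term.var (r _ x)
  | _, Term.const c => Term.const c
  | _, Term.app s t => Term.app (s.rename r) (t.rename r)

def Formula.rename : {Γ Δ : Ctx} → Ren Γ Δ → Formula Γ → Formula Δ
  | _, _, r, Formula.eq s t => Formula.eq (s.rename r) (t.rename r)
  | _, _, r, Formula.lt s t => Formula.lt (s.rename r) (t.rename r)
  | _, _, _, Formula.falsum => Formula.falsum
  | _, _, r, Formula.imp A B => Formula.imp (A.rename r) (B.rename r)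
  | _, _, r, Formula.all σ A => Formula.all σ (A.rename (r.lift σ))

/-- Weakening by one new variable (with index `0`). -/
def Term.wk {Γ : Ctx} {σ τ : Ty} (t : Term Γ σ) : Term (τ :: Γ) σ :=
  t.rename (fun _ x => Var.there x)

def Formula.wk {Γ : Ctx} {τ : Ty} (A : Formula Γ) : Formula (τ :: Γ) :=
  A.rename (fun _ x => Var.there x)

def Sub (Γ Δ : Ctx) : Type := ∀ σ : Ty, Var Γ σ → Term Δ σ

def Sub.lift {Γ Δ : Ctx} (s : Sub Γ Δ) (τ : Ty) : Sub (τ :: Γ) (τ :: Δ)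
  | _, Var.here => Term.var Var.here
  | _, Var.there x => (s _ x).wk

/-- The substitution `s` extended by the value `t` for the variable `0`. -/
def Sub.cons {Γ Δ : Ctx} {τ : Ty} (t : Term Δ τ) (s : Sub Γ Δ) : Sub (τ :: Γ) Δ
  | _, Var.here => t
  | _, Var.there x => s _ x

def Sub.id (Γ : Ctx) : Sub Γ Γ := fun _ x => Term.var x

def Term.subst {Γ Δ : Ctx} (s : Sub Γ Δ) : {σ : Ty} → Term Γ σ → Term Δ σ
  | _, Term.var x => s _ x
  | _, Term.const c => Term.const c
  | _, Term.app u t => Term.app (u.subst s) (t.subst s)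

def Formula.subst : {Γ Δ : Ctx} → Sub Γ Δ → Formula Γ → Formula Δ
  | _, _, s, Formula.eq u t => Formula.eq (u.subst s) (t.subst s)
  | _, _, s, Formula.lt u t => Formula.lt (u.subst s) (t.subst s)
  | _, _, _, Formula.falsum => Formula.falsum
  | _, _, s, Formula.imp A B => Formula.imp (A.subst s) (B.subst s)
  | _, _, s, Formula.all σ A => Formula.all σ (A.subst (s.lift σ))

/-- `A[t/x]`, where `x` is the variable `0`. -/
def Formula.inst {Γ : Ctx} {τ : Ty} (A : Formula (τ :: Γ)) (t : Term Γ τ) : Formula Γ :=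
  A.subst (Sub.cons t (Sub.id Γ))

/-! ## Abbreviations -/

abbrev v0 {Γ : Ctx} {a : Ty} : Term (a :: Γ) a := Term.var Var.here
abbrev v1 {Γ : Ctx} {a b : Ty} : Term (b :: a :: Γ) a := Term.var (Var.there Var.here)
abbrev v2 {Γ : Ctx} {a b c : Ty} : Term (c :: b :: a :: Γ) a :=
  Term.var (Var.there (Var.there Var.here))
abbrev v3 {Γ : Ctx} {a b c d : Ty} : Term (d :: c :: b :: a :: Γ) a :=
  Term.var (Var.there (Var.there (Var.there Var.here)))

infixl:90 " ⬝ₜ " => HORM.Term.app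
infixr:40 " ⟹ " => HORM.Formula.imp
infix:60 " =ₜ " => HORM.Formula.eq
infix:60 " <ₜ " => HORM.Formula.lt

def zero {Γ : Ctx} : Term Γ Ty.nat := Term.const Const.zero
def one {Γ : Ctx} : Term Γ Ty.nat := Term.const Const.one
def add {Γ : Ctx} (s t : Term Γ Ty.nat) : Term Γ Ty.nat := Term.const Const.add ⬝ₜ s ⬝ₜ t
def mul {Γ : Ctx} (s t : Term Γ Ty.nat) : Term Γ Ty.nat := Term.const Const.mul ⬝ₜ s ⬝ₜ t

def Formula.neg {Γ : Ctx} (A : Formula Γ) : Formula Γ := A ⟹ Formula.falsum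
def Formula.and {Γ : Ctx} (A B : Formula Γ) : Formula Γ := (A ⟹ B.neg).neg
def Formula.or {Γ : Ctx} (A B : Formula Γ) : Formula Γ := A.neg ⟹ B
def Formula.iff {Γ : Ctx} (A B : Formula Γ) : Formula Γ := (A ⟹ B).and (B ⟹ A)
def Formula.ex {Γ : Ctx} (σ : Ty) (A : Formula (σ :: Γ)) : Formula Γ :=
  (Formula.all σ A.neg).neg

infixr:50 " ⋏ " => HORM.Formula.and
infixr:45 " ⋎ " => HORM.Formula.or
infix:35 " ⟺ " => HORM.Formula.iff

/-- `s ≤₀ t`. -/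
def le {Γ : Ctx} (s t : Term Γ Ty.nat) : Formula Γ := s <ₜ t ⋎ s =ₜ t

/-- Equality `s =_τ t` at type `τ = τ₁ → ⋯ → τₖ → 0`, i.e. `∀ z₁ ⋯ zₖ, s z₁ ⋯ zₖ =₀ t z₁ ⋯ zₖ`. -/
def eqAt : {Γ : Ctx} → (τ : Ty) → Term Γ τ → Term Γ τ → Formula Γ
  | _, Ty.nat, s, t => s =ₜ t
  | _, Ty.arr σ τ, s, t => Formula.all σ (eqAt τ (s.wk ⬝ₜ v0) (t.wk ⬝ₜ v0))

/-- `t ≤_τ 1`, i.e. `∀ z₁ ⋯ zₖ, t z₁ ⋯ zₖ ≤₀ 1`. At type `1` this says `t ∈ C`, where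
`C` is Cantor space. -/
def leOne : {Γ : Ctx} → (τ : Ty) → Term Γ τ → Formula Γ
  | _, Ty.nat, t => le t one
  | _, Ty.arr σ τ, t => Formula.all σ (leOne τ (t.wk ⬝ₜ v0))

/-- Quantifier-free formulas (with variables of any type). -/
def Formula.QF : {Γ : Ctx} → Formula Γ → Prop
  | _, Formula.eq _ _ => True
  | _, Formula.lt _ _ => True
  | _, Formula.falsum => True
  | _, Formula.imp A B => A.QF ∧ B.QF
  | _, Formula.all _ _ => False

/-! ## Provability: natural deduction for classical many-sorted predicate logic -/

/-- A theory is a collection of axioms; axioms may have free variables (parameters). -/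
def Theory : Type := (Γ : Ctx) → Formula Γ → Prop

/-- `Derives T Γ H A`: from the axioms of `T` and the open assumptions `H`, with eigenvariables
in `Γ`, the formula `A` is derivable. -/
inductive Derives (T : Theory) : (Γ : Ctx) → List (Formula Γ) → Formula Γ → Prop
  | ax {Γ : Ctx} {H : List (Formula Γ)} {A : Formula Γ} : T Γ A → Derives T Γ H A
  | hyp {Γ : Ctx} {H : List (Formula Γ)} {A : Formula Γ} : A ∈ H → Derives T Γ H A
  | impI {Γ : Ctx} {H : List (Formula Γ)} {A B : Formula Γ} :
      Derives T Γ (A :: H) B → Derives T Γ H (A ⟹ B)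
  | impE {Γ : Ctx} {H : List (Formula Γ)} {A B : Formula Γ} :
      Derives T Γ H (A ⟹ B) → Derives T Γ H A → Derives T Γ H B
  | allI {Γ : Ctx} {H : List (Formula Γ)} {σ : Ty} {A : Formula (σ :: Γ)} :
      Derives T (σ :: Γ) (H.map Formula.wk) A → Derives T Γ H (Formula.all σ A)
  | allE {Γ : Ctx} {H : List (Formula Γ)} {σ : Ty} {A : Formula (σ :: Γ)} (t : Term Γ σ) :
      Derives T Γ H (Formula.all σ A) → Derives T Γ H (A.inst t)
  | raa {Γ : Ctx} {H : List (Formula Γ)} {A : Formula Γ} :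
      Derives T Γ (A.neg :: H) Formula.falsum → Derives T Γ H A

/-- The theory `T` proves the sentence `A`. -/
def Proves (T : Theory) (A : Formula []) : Prop := Derives T [] [] A

/-! ## Axioms -/

/-- Universal closures over one, two, three and four numbers. -/
abbrev all1 {Γ : Ctx} (A : Formula (Ty.nat :: Γ)) : Formula Γ := Formula.all Ty.nat A
abbrev all2 {Γ : Ctx} (A : Formula (Ty.nat :: Ty.nat :: Γ)) : Formula Γ := all1 (all1 A)
abbrev all3 {Γ : Ctx} (A : Formula (Ty.nat :: Ty.nat :: Ty.nat :: Γ)) : Formula Γ :=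
  all1 (all2 A)
abbrev all4 {Γ : Ctx} (A : Formula (Ty.nat :: Ty.nat :: Ty.nat :: Ty.nat :: Γ)) : Formula Γ :=
  all1 (all3 A)

/-- `0, 1, <, +, ×` form an ordered semi-ring with equality `=₀`. (Congruence of `+` and `×` is
an instance of the axiom of extensionality.) -/
inductive BasicAx : Theory
  | eq_refl {Γ : Ctx} : BasicAx Γ (all1 (v0 =ₜ v0))
  | eq_symm {Γ : Ctx} : BasicAx Γ (all2 (v1 =ₜ v0 ⟹ v0 =ₜ v1))
  | eq_trans {Γ : Ctx} : BasicAx Γ (all3 (v2 =ₜ v1 ⟹ v1 =ₜ v0 ⟹ v2 =ₜ v0))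
  | lt_congr {Γ : Ctx} : BasicAx Γ (all4 (v3 =ₜ v2 ⟹ v1 =ₜ v0 ⟹ v3 <ₜ v1 ⟹ v2 <ₜ v0))
  | add_assoc {Γ : Ctx} : BasicAx Γ (all3 (add (add v2 v1) v0 =ₜ add v2 (add v1 v0)))
  | add_comm {Γ : Ctx} : BasicAx Γ (all2 (add v1 v0 =ₜ add v0 v1))
  | add_zero {Γ : Ctx} : BasicAx Γ (all1 (add v0 zero =ₜ v0))
  | mul_assoc {Γ : Ctx} : BasicAx Γ (all3 (mul (mul v2 v1) v0 =ₜ mul v2 (mul v1 v0)))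
  | mul_comm {Γ : Ctx} : BasicAx Γ (all2 (mul v1 v0 =ₜ mul v0 v1))
  | mul_one {Γ : Ctx} : BasicAx Γ (all1 (mul v0 one =ₜ v0))
  | mul_zero {Γ : Ctx} : BasicAx Γ (all1 (mul v0 zero =ₜ zero))
  | mul_add {Γ : Ctx} : BasicAx Γ (all3 (mul v2 (add v1 v0) =ₜ add (mul v2 v1) (mul v2 v0)))
  | lt_irrefl {Γ : Ctx} : BasicAx Γ (all1 (v0 <ₜ v0).neg)
  | lt_trans {Γ : Ctx} : BasicAx Γ (all3 (v2 <ₜ v1 ⟹ v1 <ₜ v0 ⟹ v2 <ₜ v0))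
  | lt_total {Γ : Ctx} : BasicAx Γ (all2 (v1 <ₜ v0 ⋎ v1 =ₜ v0 ⋎ v0 <ₜ v1))
  | zero_lt_one {Γ : Ctx} : BasicAx Γ (zero <ₜ one)
  | add_lt_add {Γ : Ctx} : BasicAx Γ (all3 (v2 <ₜ v1 ⟹ add v2 v0 <ₜ add v1 v0))
  | mul_lt_mul {Γ : Ctx} :
      BasicAx Γ (all3 (v2 <ₜ v1 ⟹ zero <ₜ v0 ⟹ mul v2 v0 <ₜ mul v1 v0))

/-- The substitution `n ↦ n + 1` for the variable `n = v0`. -/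
def succSub (Γ : Ctx) : Sub (Ty.nat :: Γ) (Ty.nat :: Γ) :=
  Sub.cons (add v0 one) (fun _ x => Term.var (Var.there x))

/-- From parameters, `x` and `y` to parameters, `Y` and `x`: the substitution `y ↦ Y x`. -/
def choiceSub (Γ : Ctx) (σ τ : Ty) : Sub (τ :: σ :: Γ) (σ :: Ty.arr σ τ :: Γ) :=
  Sub.cons (v1 ⬝ₜ v0) (Sub.cons v0 (fun _ x => Term.var (Var.there (Var.there x))))

/-- `QF-AC^{σ,τ}`: `∀ x ∃ y A(x, y) → ∃ Y ∀ x A(x, Y x)` for quantifier-free `A`. -/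
inductive QFAC (σ τ : Ty) : Theory
  | choice {Γ : Ctx} (A : Formula (τ :: σ :: Γ)) (hA : A.QF) :
      QFAC σ τ Γ (Formula.all σ (Formula.ex τ A) ⟹
        Formula.ex (Ty.arr σ τ) (Formula.all σ (A.subst (choiceSub Γ σ τ))))

/-- The axioms of `RCA₀^ω`. -/
inductive RCA0omega : Theory
  | basic {Γ : Ctx} {A : Formula Γ} : BasicAx Γ A → RCA0omega Γ A
  | combPi {Γ : Ctx} (σ τ : Ty) : RCA0omega Γ
      (Formula.all σ (Formula.all τ (eqAt σ (Term.const (Const.combPi σ τ) ⬝ₜ v1 ⬝ₜ v0) v1)))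
  | combSigma {Γ : Ctx} (ρ σ τ : Ty) : RCA0omega Γ
      (Formula.all (Ty.arr ρ (Ty.arr σ τ)) (Formula.all (Ty.arr ρ σ) (Formula.all ρ
        (eqAt τ (Term.const (Const.combSigma ρ σ τ) ⬝ₜ v2 ⬝ₜ v1 ⬝ₜ v0)
          (v2 ⬝ₜ v0 ⬝ₜ (v1 ⬝ₜ v0))))))
  | rec_zero {Γ : Ctx} : RCA0omega Γ
      (Formula.all Ty.one (Formula.all Ty.nat
        (Term.const (Const.recursor Ty.nat) ⬝ₜ v1 ⬝ₜ v0 ⬝ₜ zero =ₜ v0)))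
  | rec_succ {Γ : Ctx} : RCA0omega Γ
      (Formula.all Ty.one (Formula.all Ty.nat (Formula.all Ty.nat
        (Term.const (Const.recursor Ty.nat) ⬝ₜ v2 ⬝ₜ v1 ⬝ₜ add v0 one =ₜ
          v2 ⬝ₜ (Term.const (Const.recursor Ty.nat) ⬝ₜ v2 ⬝ₜ v1 ⬝ₜ v0)))))
  | ext {Γ : Ctx} (ρ τ : Ty) : RCA0omega Γ
      (Formula.all ρ (Formula.all ρ (Formula.all (Ty.arr ρ τ)
        (eqAt ρ v2 v1 ⟹ eqAt τ (v0 ⬝ₜ v2) (v0 ⬝ₜ v1)))))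
  | ind {Γ : Ctx} (A : Formula (Ty.nat :: Γ)) (hA : A.QF) : RCA0omega Γ
      (A.inst zero ⟹ Formula.all Ty.nat (A ⟹ A.subst (succSub Γ)) ⟹ Formula.all Ty.nat A)
  | qfac {Γ : Ctx} {A : Formula Γ} : QFAC Ty.one Ty.nat Γ A → RCA0omega Γ A

/-- `RCA₀^ω + QF-AC^{2,0}`. -/
def RCA0omegaQFAC20 : Theory := fun Γ A => RCA0omega Γ A ∨ QFAC Ty.two Ty.nat Γ A

/-! ## The principles -/

/-- Equality of initial segments `f̄ N = ḡ N`, i.e. `f(i) = g(i)` for all `i < N`. -/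
def agree {Γ : Ctx} (f g : Term Γ Ty.one) (N : Term Γ Ty.nat) : Formula Γ :=
  Formula.all Ty.nat (v0 <ₜ N.wk ⟹ f.wk ⬝ₜ v0 =ₜ g.wk ⬝ₜ v0)

/-- `f ∈ C`, i.e. `f ≤₁ 1`. -/
def inC {Γ : Ctx} (f : Term Γ Ty.one) : Formula Γ := leOne Ty.one f

/-- `Y ∈ cont`: `∀ f ∃ N ∀ g (f̄ N = ḡ N → Y(f) = Y(g))`. -/
def cont {Γ : Ctx} (Y : Term Γ Ty.two) : Formula Γ :=
  Formula.all Ty.one (Formula.ex Ty.nat (Formula.all Ty.one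
    (agree v2 v0 v1 ⟹ Y.wk.wk.wk ⬝ₜ v2 =ₜ Y.wk.wk.wk ⬝ₜ v0)))

/-- An injective pairing of numbers: `(a + b)² + a`. -/
def pair {Γ : Ctx} (a b : Term Γ Ty.nat) : Term Γ Ty.nat :=
  add (mul (add a b) (add a b)) a

/-- `h(n)` is the code `ḡ n` of the finite sequence `⟨g(0), …, g(n-1)⟩`, for every `n`.
The empty sequence has code `0`, and the code of the sequence `s` followed by `a` is
`pair (code s) a + 1`. Each `g` has exactly one such `h`. -/
def isBar {Γ : Ctx} (g h : Term Γ Ty.one) : Formula Γ :=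
  h ⬝ₜ zero =ₜ zero ⋏
    Formula.all Ty.nat (h.wk ⬝ₜ add v0 one =ₜ add (pair (h.wk ⬝ₜ v0) (g.wk ⬝ₜ v0)) one)

/-- `MUC`: `∃ Ω³ ∀ Y² ∀ f, g ∈ C (f̄ Ω(Y) = ḡ Ω(Y) → Y(f) = Y(g))`. -/
def MUC : Formula [] :=
  Formula.ex Ty.three (Formula.all Ty.two (Formula.all Ty.one (Formula.all Ty.one
    (inC v1 ⟹ inC v0 ⟹ agree v1 v0 (v3 ⬝ₜ v2) ⟹ v2 ⬝ₜ v1 =ₜ v2 ⬝ₜ v0))))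

/-- `FF`: `∃ Φ³ ∀ Y² ∈ cont ∀ f, g ∈ C (f̄ Φ(Y) = ḡ Φ(Y) → Y(f) = Y(g))`. -/
def FF : Formula [] :=
  Formula.ex Ty.three (Formula.all Ty.two (cont v0 ⟹ Formula.all Ty.one (Formula.all Ty.one
    (inC v1 ⟹ inC v0 ⟹ agree v1 v0 (v3 ⬝ₜ v2) ⟹ v2 ⬝ₜ v1 =ₜ v2 ⬝ₜ v0))))

/-- `(∃²)`: `∃ φ² ≤₂ 1 ∀ f¹ [∃ n (f(n) = 0) ↔ φ(f) = 0]`. -/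
def Exists2 : Formula [] :=
  Formula.ex Ty.two (leOne Ty.two v0 ⋏ Formula.all Ty.one
    (Formula.ex Ty.nat (v1 ⬝ₜ v0 =ₜ zero) ⟺ v1 ⬝ₜ v0 =ₜ zero))

/-- `(S²)`: `∃ S² ≤₂ 1 ∀ f¹ [∃ g¹ ∀ n (f(ḡ n) = 0) ↔ S(f) = 0]`, where `ḡ n` is written `h(n)`
for the function `h` of codes of initial segments of `g`. -/
def Suslin2 : Formula [] :=
  Formula.ex Ty.two (leOne Ty.two v0 ⋏ Formula.all Ty.one
    (Formula.ex Ty.one (Formula.ex Ty.one (isBar v1 v0 ⋏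
      Formula.all Ty.nat (v3 ⬝ₜ (v1 ⬝ₜ v0) =ₜ zero))) ⟺ v1 ⬝ₜ v0 =ₜ zero))

/-- `(∃³)`: `∃ E³ ≤₃ 1 ∀ Y² [∃ f¹ (Y(f) = 0) ↔ E(Y) = 0]`. -/
def Exists3 : Formula [] :=
  Formula.ex Ty.three (leOne Ty.three v0 ⋏ Formula.all Ty.two
    (Formula.ex Ty.one (v1 ⬝ₜ v0 =ₜ zero) ⟺ v1 ⬝ₜ v0 =ₜ zero))

/-- `(Z³)`: `∃ Z³ ∀ Y² [Z(Y) = 0 ↔ ∀ f ∃ N ∀ g (f̄ N = ḡ N → Y(f) = Y(g))]`. -/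
def Z3 : Formula [] :=
  Formula.ex Ty.three (Formula.all Ty.two (v1 ⬝ₜ v0 =ₜ zero ⟺ cont v0))

end HORM

namespace HORM

/-! ## Substitution calculus -/

def Ren.shift {Γ : Ctx} (τ : Ty) : Ren Γ (τ :: Γ) := fun _ x => Var.there x

def Ren.comp {Γ Δ Θ : Ctx} (r : Ren Γ Δ) (r' : Ren Δ Θ) : Ren Γ Θ := fun σ x => r' σ (r σ x)

def Sub.precompRen {Γ Δ Θ : Ctx} (r : Ren Γ Δ) (s : Sub Δ Θ) : Sub Γ Θ := fun σ x => s σ (r σ x)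

def Sub.compRen {Γ Δ Θ : Ctx} (s : Sub Γ Δ) (r : Ren Δ Θ) : Sub Γ Θ :=
  fun σ x => (s σ x).rename r

def Sub.comp {Γ Δ Θ : Ctx} (s : Sub Γ Δ) (s' : Sub Δ Θ) : Sub Γ Θ :=
  fun σ x => (s σ x).subst s'

theorem Term.wk_eq_rename {Γ : Ctx} {σ τ : Ty} (t : Term Γ σ) :
    t.wk = t.rename (Ren.shift τ) := rfl

theorem Formula.wk_eq_rename {Γ : Ctx} {τ : Ty} (A : Formula Γ) :
    A.wk = A.rename (Ren.shift τ) := rfl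

theorem Ren.lift_comp {Γ Δ Θ : Ctx} (r : Ren Γ Δ) (r' : Ren Δ Θ) (τ : Ty) :
    (r.comp r').lift τ = (r.lift τ).comp (r'.lift τ) := by
  funext σ x
  cases x <;> rfl

theorem Term.rename_rename {Γ Δ Θ : Ctx} (r : Ren Γ Δ) (r' : Ren Δ Θ) :
    ∀ {σ : Ty} (t : Term Γ σ), (t.rename r).rename r' = t.rename (r.comp r')
  | _, Term.var _ => rfl
  | _, Term.const _ => rfl
  | _, Term.app s t => by simp [Term.rename, Term.rename_rename r r' s, Term.rename_rename r r' t]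

theorem Formula.rename_rename : ∀ {Γ Δ Θ : Ctx} (A : Formula Γ) (r : Ren Γ Δ) (r' : Ren Δ Θ),
    (A.rename r).rename r' = A.rename (r.comp r')
  | _, _, _, Formula.eq s t, r, r' => by simp [Formula.rename, Term.rename_rename]
  | _, _, _, Formula.lt s t, r, r' => by simp [Formula.rename, Term.rename_rename]
  | _, _, _, Formula.falsum, _, _ => rfl
  | _, _, _, Formula.imp A B, r, r' => by
      simp [Formula.rename, Formula.rename_rename A, Formula.rename_rename B]
  | _, _, _, Formula.all σ A, r, r' => by
      simp [Formula.rename, Formula.rename_rename A, Ren.lift_comp]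

theorem Sub.lift_comp_ren {Γ Δ Θ : Ctx} (r : Ren Γ Δ) (s : Sub Δ Θ) (τ : Ty) :
    (Sub.precompRen r s).lift τ = Sub.precompRen (r.lift τ) (s.lift τ) := by
  funext σ x
  cases x <;> rfl

theorem Term.subst_rename {Γ Δ Θ : Ctx} (r : Ren Γ Δ) (s : Sub Δ Θ) :
    ∀ {σ : Ty} (t : Term Γ σ), (t.rename r).subst s = t.subst (Sub.precompRen r s)
  | _, Term.var _ => rfl
  | _, Term.const _ => rfl
  | _, Term.app u t => by
      simp [Term.rename, Term.subst, Term.subst_rename r s u, Term.subst_rename r s t]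

theorem Formula.subst_rename : ∀ {Γ Δ Θ : Ctx} (A : Formula Γ) (r : Ren Γ Δ) (s : Sub Δ Θ),
    (A.rename r).subst s = A.subst (Sub.precompRen r s)
  | _, _, _, Formula.eq s t, r, r' => by simp [Formula.rename, Formula.subst, Term.subst_rename]
  | _, _, _, Formula.lt s t, r, r' => by simp [Formula.rename, Formula.subst, Term.subst_rename]
  | _, _, _, Formula.falsum, _, _ => rfl
  | _, _, _, Formula.imp A B, r, r' => by
      simp [Formula.rename, Formula.subst, Formula.subst_rename A, Formula.subst_rename B]
  | _, _, _, Formula.all σ A, r, r' => by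
      simp [Formula.rename, Formula.subst, Formula.subst_rename A, Sub.lift_comp_ren]

theorem Term.rename_subst {Γ Δ Θ : Ctx} (s : Sub Γ Δ) (r : Ren Δ Θ) :
    ∀ {σ : Ty} (t : Term Γ σ), (t.subst s).rename r = t.subst (s.compRen r)
  | _, Term.var _ => rfl
  | _, Term.const _ => rfl
  | _, Term.app u t => by
      simp [Term.rename, Term.subst, Term.rename_subst s r u, Term.rename_subst s r t]

theorem Sub.lift_rename {Γ Δ Θ : Ctx} (s : Sub Γ Δ) (r : Ren Δ Θ) (τ : Ty) :
    (s.compRen r).lift τ = (s.lift τ).compRen (r.lift τ) := by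
  funext σ x
  cases x with
  | here => rfl
  | there x => 
      simp only [Sub.lift, Sub.compRen, Term.wk_eq_rename, Term.rename_rename]; rfl

theorem Formula.rename_subst : ∀ {Γ Δ Θ : Ctx} (A : Formula Γ) (s : Sub Γ Δ) (r : Ren Δ Θ),
    (A.subst s).rename r = A.subst (s.compRen r)
  | _, _, _, Formula.eq s t, r, r' => by simp [Formula.rename, Formula.subst, Term.rename_subst]
  | _, _, _, Formula.lt s t, r, r' => by simp [Formula.rename, Formula.subst, Term.rename_subst]
  | _, _, _, Formula.falsum, _, _ => rfl
  | _, _, _, Formula.imp A B, r, r' => by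
      simp [Formula.rename, Formula.subst, Formula.rename_subst A, Formula.rename_subst B]
  | _, _, _, Formula.all σ A, r, r' => by
      simp [Formula.rename, Formula.subst, Formula.rename_subst A, Sub.lift_rename]

theorem Term.subst_subst {Γ Δ Θ : Ctx} (s : Sub Γ Δ) (s' : Sub Δ Θ) :
    ∀ {σ : Ty} (t : Term Γ σ), (t.subst s).subst s' = t.subst (s.comp s')
  | _, Term.var _ => rfl
  | _, Term.const _ => rfl
  | _, Term.app u t => by
      simp [Term.subst, Term.subst_subst s s' u, Term.subst_subst s s' t]

theorem Term.wk_subst_lift {Γ Δ : Ctx} {σ τ : Ty} (t : Term Γ σ) (s : Sub Γ Δ) :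
    (t.wk (τ := τ)).subst (s.lift τ) = (t.subst s).wk := by
  simp only [Term.wk_eq_rename, Term.subst_rename, Term.rename_subst]; rfl

theorem Sub.lift_subst {Γ Δ Θ : Ctx} (s : Sub Γ Δ) (s' : Sub Δ Θ) (τ : Ty) :
    (s.comp s').lift τ = (s.lift τ).comp (s'.lift τ) := by
  funext σ x
  cases x with
  | here => rfl
  | there x => exact (Term.wk_subst_lift _ _).symm

theorem Formula.subst_subst : ∀ {Γ Δ Θ : Ctx} (A : Formula Γ) (s : Sub Γ Δ) (s' : Sub Δ Θ),
    (A.subst s).subst s' = A.subst (s.comp s')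
  | _, _, _, Formula.eq s t, r, r' => by simp [Formula.subst, Term.subst_subst]
  | _, _, _, Formula.lt s t, r, r' => by simp [Formula.subst, Term.subst_subst]
  | _, _, _, Formula.falsum, _, _ => rfl
  | _, _, _, Formula.imp A B, r, r' => by
      simp [Formula.subst, Formula.subst_subst A, Formula.subst_subst B]
  | _, _, _, Formula.all σ A, r, r' => by
      simp [Formula.subst, Formula.subst_subst A, Sub.lift_subst]

theorem Term.subst_id {Γ : Ctx} : ∀ {σ : Ty} (t : Term Γ σ), t.subst (Sub.id Γ) = t
  | _, Term.var _ => rfl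
  | _, Term.const _ => rfl
  | _, Term.app u t => by simp [Term.subst, Term.subst_id u, Term.subst_id t]

theorem Sub.lift_id (Γ : Ctx) (τ : Ty) : (Sub.id Γ).lift τ = Sub.id (τ :: Γ) := by
  funext σ x
  cases x <;> rfl

theorem Formula.subst_id : ∀ {Γ : Ctx} (A : Formula Γ), A.subst (Sub.id Γ) = A
  | _, Formula.eq s t => by simp [Formula.subst, Term.subst_id]
  | _, Formula.lt s t => by simp [Formula.subst, Term.subst_id]
  | _, Formula.falsum => rfl
  | _, Formula.imp A B => by simp [Formula.subst, Formula.subst_id A, Formula.subst_id B]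
  | _, Formula.all σ A => by simp [Formula.subst, Formula.subst_id A, Sub.lift_id]

theorem Formula.QF.subst : ∀ {Γ Δ : Ctx} {A : Formula Γ} (s : Sub Γ Δ), A.QF → (A.subst s).QF
  | _, _, Formula.eq _ _, _, _ => trivial
  | _, _, Formula.lt _ _, _, _ => trivial
  | _, _, Formula.falsum, _, _ => trivial
  | _, _, Formula.imp _ _, s, h => ⟨Formula.QF.subst s h.1, Formula.QF.subst s h.2⟩
  | _, _, Formula.all _ _, _, h => h.elim

theorem Term.rename_eq_subst {Γ Δ : Ctx} {σ : Ty} (t : Term Γ σ) (r : Ren Γ Δ) :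
    t.rename r = t.subst (fun _ x => Term.var (r _ x)) := by
  have := Term.rename_subst (Sub.id _) r t
  rw [Term.subst_id] at this
  exact this

/-! ## The axioms are closed under substitution -/

theorem eqAt_subst : ∀ {Γ Δ : Ctx} (τ : Ty) (s t : Term Γ τ) (u : Sub Γ Δ),
    (eqAt τ s t).subst u = eqAt τ (s.subst u) (t.subst u)
  | _, _, Ty.nat, _, _, _ => rfl
  | _, _, Ty.arr σ τ, s, t, u => by
      simp only [eqAt, Formula.subst, eqAt_subst τ, Term.subst, Term.wk_subst_lift, Sub.lift]

theorem BasicAx.subst {Γ Δ : Ctx} {A : Formula Γ} (h : BasicAx Γ A) (s : Sub Γ Δ) :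
    BasicAx Δ (A.subst s) := by
  cases h <;> constructor

theorem QFAC.subst {σ τ : Ty} {Γ Δ : Ctx} {A : Formula Γ} (h : QFAC σ τ Γ A) (s : Sub Γ Δ) :
    QFAC σ τ Δ (A.subst s) := by
  cases h with
  | choice A hA =>
    have key : (A.subst (choiceSub Γ σ τ)).subst ((s.lift (Ty.arr σ τ)).lift σ) =
        (A.subst ((s.lift σ).lift τ)).subst (choiceSub Δ σ τ) := by
      rw [Formula.subst_subst, Formula.subst_subst]
      congr 1
      funext ρ x
      rcases x with _ | _ | x
      · rfl
      · rfl
      · change (s _ x).wk.wk = (s _ x).wk.wk.subst _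
        simp only [Term.wk_eq_rename, Term.rename_rename, Term.subst_rename]
        exact Term.rename_eq_subst _ _
    have := QFAC.choice (Γ := Δ) (A.subst ((s.lift σ).lift τ)) (hA.subst _)
    rw [← key] at this
    exact this

/-- The schemas allow arbitrary parameters, so an instance stays an instance when terms replace
them. In the term model the parameters take terms as values, and this closure makes the axioms true
there. -/
theorem RCA0omega.subst {Γ Δ : Ctx} {A : Formula Γ} (h : RCA0omega Γ A) (s : Sub Γ Δ) :
    RCA0omega Δ (A.subst s) := by
  cases h with
  | basic h => exact .basic (h.subst s)
  | combPi σ τ =>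
    have := RCA0omega.combPi (Γ := Δ) σ τ
    simp only [Formula.subst, eqAt_subst]
    exact this
  | combSigma ρ σ τ =>
    have := RCA0omega.combSigma (Γ := Δ) ρ σ τ
    simp only [Formula.subst, eqAt_subst]
    exact this
  | rec_zero => exact .rec_zero
  | rec_succ => exact .rec_succ
  | ext ρ τ =>
    have := RCA0omega.ext (Γ := Δ) ρ τ
    simp only [Formula.subst, eqAt_subst]
    exact this
  | ind A hA =>
    have := RCA0omega.ind (Γ := Δ) (A.subst (s.lift _)) (hA.subst _)
    have k0 : (A.inst zero).subst s = (A.subst (s.lift _)).inst zero := by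
      simp only [Formula.inst, Formula.subst_subst]
      congr 1
      funext ρ x
      rcases x with _ | x
      · rfl
      · change s _ x = (s _ x).wk.subst _
        simp only [Term.wk_eq_rename, Term.subst_rename]
        exact (Term.subst_id _).symm
    have k1 : (A.subst (succSub Γ)).subst (s.lift _) =
        (A.subst (s.lift _)).subst (succSub Δ) := by
      simp only [Formula.subst_subst]
      congr 1
      funext ρ x
      rcases x with _ | x
      · rfl
      · change (s _ x).wk = (s _ x).wk.subst _
        simp only [Term.wk_eq_rename, Term.subst_rename]
        exact Term.rename_eq_subst _ _
    rw [← k0, ← k1] at this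
    exact this
  | qfac h => exact .qfac (h.subst s)

theorem RCA0omegaQFAC20.subst {Γ Δ : Ctx} {A : Formula Γ} (h : RCA0omegaQFAC20 Γ A)
    (s : Sub Γ Δ) : RCA0omegaQFAC20 Δ (A.subst s) :=
  h.imp (fun h => h.subst s) (fun h => h.subst s)


/-! ## Structures and satisfaction -/

/-- Structures for the language, with an arbitrary relation interpreting `=₀`. -/
structure Str where
  D : Ty → Type
  ap : ∀ {σ τ : Ty}, D (Ty.arr σ τ) → D σ → D τ
  cst : ∀ {σ : Ty}, Const σ → D σ
  eq : D Ty.nat → D Ty.nat → Prop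
  lt : D Ty.nat → D Ty.nat → Prop

namespace Str

/-- Assignments of values to the variables of a context. -/
def Env (M : Str) (Γ : Ctx) : Type := ∀ σ : Ty, Var Γ σ → M.D σ

variable {M : Str}

def nil : M.Env [] := fun _ x => nomatch x

def cons {Γ : Ctx} {τ : Ty} (a : M.D τ) (ρ : M.Env Γ) : M.Env (τ :: Γ)
  | _, Var.here => a
  | _, Var.there x => ρ _ x

def eval {Γ : Ctx} (ρ : M.Env Γ) : {σ : Ty} → Term Γ σ → M.D σ
  | _, Term.var x => ρ _ x
  | _, Term.const c => M.cst c
  | _, Term.app s t => M.ap (eval ρ s) (eval ρ t)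

def sat : {Γ : Ctx} → M.Env Γ → Formula Γ → Prop
  | _, ρ, Formula.eq s t => M.eq (eval ρ s) (eval ρ t)
  | _, ρ, Formula.lt s t => M.lt (eval ρ s) (eval ρ t)
  | _, _, Formula.falsum => False
  | _, ρ, Formula.imp A B => sat ρ A → sat ρ B
  | _, ρ, Formula.all σ A => ∀ a : M.D σ, sat (cons a ρ) A

/-- Reindexing of an assignment along a substitution. -/
def Env.pull {Γ Δ : Ctx} (ρ : M.Env Δ) (s : Sub Γ Δ) : M.Env Γ := fun σ x => eval ρ (s σ x)

def Env.pullRen {Γ Δ : Ctx} (ρ : M.Env Δ) (r : Ren Γ Δ) : M.Env Γ := fun σ x => ρ σ (r σ x)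

theorem eval_rename {Γ Δ : Ctx} (ρ : M.Env Δ) (r : Ren Γ Δ) :
    ∀ {σ : Ty} (t : Term Γ σ), eval ρ (t.rename r) = eval (ρ.pullRen r) t
  | _, Term.var _ => rfl
  | _, Term.const _ => rfl
  | _, Term.app s t => by simp only [Term.rename, eval, eval_rename ρ r s, eval_rename ρ r t]

@[simp] theorem eval_wk {Γ : Ctx} {σ τ : Ty} (ρ : M.Env Γ) (a : M.D τ) (t : Term Γ σ) :
    eval (cons a ρ) t.wk = eval ρ t := by
  rw [Term.wk_eq_rename, eval_rename]; rfl

theorem eval_subst {Γ Δ : Ctx} (ρ : M.Env Δ) (s : Sub Γ Δ) :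
    ∀ {σ : Ty} (t : Term Γ σ), eval ρ (t.subst s) = eval (ρ.pull s) t
  | _, Term.var _ => rfl
  | _, Term.const _ => rfl
  | _, Term.app u t => by simp only [Term.subst, eval, eval_subst ρ s u, eval_subst ρ s t]

theorem pull_lift {Γ Δ : Ctx} {τ : Ty} (ρ : M.Env Δ) (s : Sub Γ Δ) (a : M.D τ) :
    (cons a ρ).pull (s.lift τ) = cons a (ρ.pull s) := by
  funext σ x
  cases x with
  | here => rfl
  | there x => exact eval_wk _ _ _

theorem sat_subst : ∀ {Γ Δ : Ctx} (A : Formula Γ) (ρ : M.Env Δ) (s : Sub Γ Δ),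
    sat ρ (A.subst s) ↔ sat (ρ.pull s) A
  | _, _, Formula.eq _ _, ρ, s => by simp only [Formula.subst, sat, eval_subst]
  | _, _, Formula.lt _ _, ρ, s => by simp only [Formula.subst, sat, eval_subst]
  | _, _, Formula.falsum, _, _ => Iff.rfl
  | _, _, Formula.imp A B, ρ, s => by
      simp only [Formula.subst, sat, sat_subst A, sat_subst B]
  | _, _, Formula.all σ A, ρ, s => by
      simp only [Formula.subst, sat, sat_subst A, pull_lift]

@[simp] theorem eval_var_here {Γ : Ctx} {τ : Ty} (ρ : M.Env Γ) (a : M.D τ) :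
    eval (cons a ρ) (Term.var Var.here) = a := rfl

@[simp] theorem eval_var_there {Γ : Ctx} {σ τ : Ty} (ρ : M.Env Γ) (a : M.D τ) (x : Var Γ σ) :
    eval (cons a ρ) (Term.var (Var.there x)) = eval ρ (Term.var x) := rfl

@[simp] theorem eval_app {Γ : Ctx} {σ τ : Ty} (ρ : M.Env Γ) (s : Term Γ (Ty.arr σ τ))
    (t : Term Γ σ) : eval ρ (s ⬝ₜ t) = M.ap (eval ρ s) (eval ρ t) := rfl

@[simp] theorem eval_const {Γ : Ctx} {σ : Ty} (ρ : M.Env Γ) (c : Const σ) :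
    eval ρ (Term.const c) = M.cst c := rfl

@[simp] theorem sat_eq {Γ : Ctx} (ρ : M.Env Γ) (s t : Term Γ Ty.nat) :
    sat ρ (s =ₜ t) ↔ M.eq (eval ρ s) (eval ρ t) := Iff.rfl

@[simp] theorem sat_lt {Γ : Ctx} (ρ : M.Env Γ) (s t : Term Γ Ty.nat) :
    sat ρ (s <ₜ t) ↔ M.lt (eval ρ s) (eval ρ t) := Iff.rfl

@[simp] theorem sat_falsum {Γ : Ctx} (ρ : M.Env Γ) : sat ρ Formula.falsum ↔ False := Iff.rfl

@[simp] theorem sat_imp {Γ : Ctx} (ρ : M.Env Γ) (A B : Formula Γ) :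
    sat ρ (A ⟹ B) ↔ (sat ρ A → sat ρ B) := Iff.rfl

@[simp] theorem sat_all {Γ : Ctx} {σ : Ty} (ρ : M.Env Γ) (A : Formula (σ :: Γ)) :
    sat ρ (Formula.all σ A) ↔ ∀ a, sat (cons a ρ) A := Iff.rfl

@[simp] theorem sat_neg {Γ : Ctx} (ρ : M.Env Γ) (A : Formula Γ) :
    sat ρ A.neg ↔ ¬ sat ρ A := Iff.rfl

@[simp] theorem sat_and {Γ : Ctx} (ρ : M.Env Γ) (A B : Formula Γ) :
    sat ρ (A ⋏ B) ↔ sat ρ A ∧ sat ρ B := by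
  simp [Formula.and]

@[simp] theorem sat_or {Γ : Ctx} (ρ : M.Env Γ) (A B : Formula Γ) :
    sat ρ (A ⋎ B) ↔ sat ρ A ∨ sat ρ B := by
  simp only [Formula.or, sat_imp, sat_neg]
  tauto

@[simp] theorem sat_iff {Γ : Ctx} (ρ : M.Env Γ) (A B : Formula Γ) :
    sat ρ (A ⟺ B) ↔ (sat ρ A ↔ sat ρ B) := by
  simp only [Formula.iff, sat_imp, sat_and]
  tauto

@[simp] theorem sat_ex {Γ : Ctx} {σ : Ty} (ρ : M.Env Γ) (A : Formula (σ :: Γ)) :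
    sat ρ (Formula.ex σ A) ↔ ∃ a, sat (cons a ρ) A := by
  simp [Formula.ex]

/-- All axioms of `T` hold in `M`, for all values of the parameters. -/
def Models (M : Str) (T : Theory) : Prop :=
  ∀ (Γ : Ctx) (A : Formula Γ) (ρ : M.Env Γ), T Γ A → sat ρ A

end Str

/-! ## Countability of the syntax -/

/-- Serves the enumeration of types and formulas in the Henkin construction. For the indexed
families, bounding the size lets the index vary during the induction. -/
theorem countable_of_size {α : Type} (size : α → ℕ)
    (h : ∀ n, {a | size a ≤ n}.Countable) : Countable α := by
  rw [← Set.countable_univ_iff]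
  have : (Set.univ : Set α) = ⋃ n, {a | size a ≤ n} := by
    ext a
    simpa using ⟨size a, le_rfl⟩
  rw [this]
  exact Set.countable_iUnion h

def Ty.size : Ty → ℕ
  | Ty.nat => 0
  | Ty.arr σ τ => σ.size + τ.size + 1

instance : Countable Ty := by
  refine countable_of_size Ty.size fun n => ?_
  induction n with
  | zero =>
    refine (Set.countable_singleton Ty.nat).mono ?_
    rintro (_ | ⟨σ, τ⟩) h
    · rfl
    · simp [Ty.size] at h
  | succ n ih =>
    refine ((Set.countable_singleton Ty.nat).union (ih.image2 ih Ty.arr)).mono ?_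
    rintro (_ | ⟨σ, τ⟩) h
    · exact Or.inl rfl
    · simp only [Ty.size, Set.mem_ofPred_eq] at h
      exact Or.inr ⟨σ, by simp; omega, τ, by simp; omega, rfl⟩

instance (Γ : Ctx) (σ : Ty) : Countable (Var Γ σ) := by
  induction Γ with
  | nil => exact ⟨⟨fun x => (nomatch x), fun x => (nomatch x)⟩⟩
  | cons τ Γ ih =>
    obtain ⟨f, hf⟩ := ih
    refine ⟨⟨fun x => match x with | Var.here => 0 | Var.there x => f x + 1, ?_⟩⟩
    rintro (_ | x) y h
    · cases y with
      | here => rfl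
      | there y => simp at h
    · cases y with
      | here => simp at h
      | there y =>
        simp only [Nat.add_right_cancel_iff] at h
        rw [hf h]

def Const.code {σ : Ty} : Const σ → ℕ × List Ty
  | Const.zero => (0, [])
  | Const.one => (1, [])
  | Const.add => (2, [])
  | Const.mul => (3, [])
  | Const.combPi σ τ => (4, [σ, τ])
  | Const.combSigma ρ σ τ => (5, [ρ, σ, τ])
  | Const.recursor σ => (6, [σ])

theorem Const.code_heq {σ τ : Ty} (c : Const σ) (d : Const τ) (h : c.code = d.code) :
    HEq c d := by
  cases c <;> cases d <;> simp [Const.code] at h ⊢ <;> aesop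

instance (σ : Ty) : Countable (Const σ) :=
  Function.Injective.countable (f := Const.code) fun c d h => eq_of_heq (c.code_heq d h)

def Term.size {Γ : Ctx} : {σ : Ty} → Term Γ σ → ℕ
  | _, Term.var _ => 0
  | _, Term.const _ => 0
  | _, Term.app s t => s.size + t.size + 1

theorem Term.countable_size_le (Γ : Ctx) (n : ℕ) :
    ∀ σ, {t : Term Γ σ | t.size ≤ n}.Countable := by
  induction n with
  | zero =>
    intro σ
    refine ((Set.countable_range Term.var).union (Set.countable_range Term.const)).mono ?_
    rintro t h
    cases t with
    | var x => exact Or.inl ⟨x, rfl⟩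
    | const c => exact Or.inr ⟨c, rfl⟩
    | app s t => simp [Term.size] at h
  | succ n ih =>
    intro σ
    refine (((Set.countable_range Term.var).union (Set.countable_range Term.const)).union
      (Set.countable_iUnion fun τ => (ih (Ty.arr τ σ)).image2 (ih τ) Term.app)).mono ?_
    rintro t h
    cases t with
    | var x => exact Or.inl (Or.inl ⟨x, rfl⟩)
    | const c => exact Or.inl (Or.inr ⟨c, rfl⟩)
    | app s t =>
      simp only [Term.size, Set.mem_ofPred_eq] at h
      exact Or.inr (Set.mem_iUnion.2 ⟨_, s, by simp; omega, t, by simp; omega, rfl⟩)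

instance (Γ : Ctx) (σ : Ty) : Countable (Term Γ σ) :=
  countable_of_size Term.size fun n => Term.countable_size_le Γ n σ

def Formula.size : {Γ : Ctx} → Formula Γ → ℕ
  | _, Formula.eq _ _ => 0
  | _, Formula.lt _ _ => 0
  | _, Formula.falsum => 0
  | _, Formula.imp A B => A.size + B.size + 1
  | _, Formula.all _ A => A.size + 1

theorem Formula.countable_size_le (n : ℕ) :
    ∀ Γ, {A : Formula Γ | A.size ≤ n}.Countable := by
  have base : ∀ Γ : Ctx, ((Set.range fun p : Term Γ Ty.nat × Term Γ Ty.nat => p.1 =ₜ p.2) ∪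
      (Set.range fun p : Term Γ Ty.nat × Term Γ Ty.nat => p.1 <ₜ p.2) ∪
      {Formula.falsum}).Countable := fun Γ =>
    ((Set.countable_range _).union (Set.countable_range _)).union (Set.countable_singleton _)
  induction n with
  | zero =>
    intro Γ
    refine (base Γ).mono ?_
    rintro A h
    cases A with
    | eq s t => exact Or.inl (Or.inl ⟨(s, t), rfl⟩)
    | lt s t => exact Or.inl (Or.inr ⟨(s, t), rfl⟩)
    | falsum => exact Or.inr rfl
    | imp A B => simp [Formula.size] at h
    | all σ A => simp [Formula.size] at h
  | succ n ih =>
    intro Γ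
    refine ((base Γ).union (((ih Γ).image2 (ih Γ) Formula.imp).union
      (Set.countable_iUnion fun τ => (ih (τ :: Γ)).image (Formula.all τ)))).mono ?_
    rintro A h
    cases A with
    | eq s t => exact Or.inl (Or.inl (Or.inl ⟨(s, t), rfl⟩))
    | lt s t => exact Or.inl (Or.inl (Or.inr ⟨(s, t), rfl⟩))
    | falsum => exact Or.inl (Or.inr rfl)
    | imp A B =>
      simp only [Formula.size, Set.mem_ofPred_eq] at h
      exact Or.inr (Or.inl ⟨A, by simp; omega, B, by simp; omega, rfl⟩)
    | all σ A =>
      simp only [Formula.size, Set.mem_ofPred_eq] at h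
      exact Or.inr (Or.inr (Set.mem_iUnion.2 ⟨σ, A, by simp; omega, rfl⟩))

instance (Γ : Ctx) : Countable (Formula Γ) :=
  countable_of_size Formula.size fun n => Formula.countable_size_le n Γ


/-! ## Consistent sets of assumptions -/

section Henkin

variable {T : Theory}

variable (T) in
def Con {Γ : Ctx} (H : List (Formula Γ)) : Prop := ¬ Derives T Γ H Formula.falsum

theorem Con.not_both {Γ : Ctx} {H : List (Formula Γ)} (c : Con T H) {A : Formula Γ}
    (h : A ∈ H) (h' : A.neg ∈ H) : False :=
  c (.impE (.hyp h') (.hyp h))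

theorem Con.of_derives {Γ : Ctx} {H : List (Formula Γ)} (c : Con T H) {A : Formula Γ}
    (d : Derives T Γ H A) : Con T (A :: H) :=
  fun d' => c (.impE (.impI d') d)

/-- Every type is inhabited by a closed term, so adding a fresh variable cannot create an
inconsistency. -/
def closedTerm : (σ : Ty) → (Γ : Ctx) → Term Γ σ
  | Ty.nat, _ => zero
  | Ty.arr σ τ, Γ => Term.const (Const.combPi τ σ) ⬝ₜ closedTerm τ Γ

theorem Con.wk {Γ : Ctx} {H : List (Formula Γ)} (c : Con T H) (τ : Ty) :
    Con T (H.map (Formula.wk (τ := τ))) :=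
  fun d => c (.allE (closedTerm τ Γ) (.allI d))

/-- The fresh variable 0 is an eigenvariable: refuting `B.neg` for it would prove the universal
statement that has been denied. -/
theorem Con.henkin {Γ : Ctx} {H : List (Formula Γ)} (c : Con T H) {τ : Ty} {B : Formula (τ :: Γ)}
    (h : (Formula.all τ B).neg ∈ H) : Con T (B.neg :: H.map Formula.wk) :=
  fun d => c (.impE (.hyp h) (.allI (.raa d)))

/-- One Henkin step: decide `A`, add a variable of type `τ`, and if a universal statement over `τ`
was rejected, make that variable its counterexample. Since the new variable has index 0, the matrix
`B` already speaks of it and no substitution is needed. -/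
theorem Con.extend {Γ : Ctx} {H : List (Formula Γ)} (c : Con T H) (τ : Ty) (A : Formula Γ) :
    ∃ H' : List (Formula (τ :: Γ)), Con T H' ∧ (∀ B ∈ H, B.wk ∈ H') ∧
      (A.wk ∈ H' ∨ A.neg.wk ∈ H') ∧
      ∀ B : Formula (τ :: Γ), A = Formula.all τ B → A.wk ∈ H' ∨ B.neg ∈ H' := by
  by_cases hA : Con T (A :: H)
  · refine ⟨(A :: H).map Formula.wk, hA.wk τ, fun B hB => ?_, ?_, fun B _ => ?_⟩
    · exact List.mem_map_of_mem (List.mem_cons_of_mem _ hB)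
    · exact Or.inl (List.mem_map_of_mem List.mem_cons_self)
    · exact Or.inl (List.mem_map_of_mem List.mem_cons_self)
  · have hn : Con T (A.neg :: H) := c.of_derives (.impI (not_not.1 hA))
    by_cases hB : ∃ B : Formula (τ :: Γ), A = Formula.all τ B
    · obtain ⟨B, rfl⟩ := hB
      refine ⟨B.neg :: ((Formula.all τ B).neg :: H).map Formula.wk,
        hn.henkin List.mem_cons_self, fun C hC => ?_, ?_, fun C hC => ?_⟩
      · exact List.mem_cons_of_mem _ (List.mem_map_of_mem (List.mem_cons_of_mem _ hC))
      · exact Or.inr (List.mem_cons_of_mem _ (List.mem_map_of_mem List.mem_cons_self))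
      · cases hC
        exact Or.inr List.mem_cons_self
    · refine ⟨(A.neg :: H).map Formula.wk, hn.wk τ, fun C hC => ?_, ?_,
        fun B h => (hB ⟨B, h⟩).elim⟩
      · exact List.mem_map_of_mem (List.mem_cons_of_mem _ hC)
      · exact Or.inr (List.mem_map_of_mem List.mem_cons_self)

/-! ## Increasing chains of contexts -/

/-- The context in which the variable added at stage `k` has type `τ k`. -/
def stage (τ : ℕ → Ty) : ℕ → Ctx
  | 0 => []
  | n + 1 => τ n :: stage τ n

variable {τ : ℕ → Ty}

/-- The inclusion of the context of an earlier stage. -/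
def up {n m : ℕ} (h : n ≤ m) : Ren (stage τ n) (stage τ m) :=
  Nat.leRec (motive := fun m _ => Ren (stage τ n) (stage τ m)) (fun _ x => x)
    (fun m _ r => r.comp (Ren.shift (τ m))) h

theorem up_self (n : ℕ) : up (τ := τ) (le_refl n) = fun _ x => x := by
  unfold up
  exact Nat.leRec_self _ _

theorem up_succ {n m : ℕ} (h : n ≤ m) :
    up (τ := τ) (Nat.le_succ_of_le h) = (up h).comp (Ren.shift (τ m)) := by
  unfold up
  exact Nat.leRec_succ _ _ h

theorem up_up {n m k : ℕ} (h : n ≤ m) (h' : m ≤ k) :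
    (up (τ := τ) h).comp (up h') = up (h.trans h') := by
  induction h' with
  | refl => rw [up_self]; rfl
  | step h' ih =>
    rw [show up (τ := τ) (Nat.le.step h') = _ from up_succ h', show
      up (τ := τ) (h.trans (Nat.le.step h')) = _ from up_succ (h.trans h'), ← ih]
    rfl

theorem Formula.rename_id {Γ : Ctx} (A : Formula Γ) : A.rename (fun _ x => x) = A := by
  have := Formula.rename_subst A (Sub.id Γ) (fun _ x => x)
  rw [Formula.subst_id] at this
  exact this.trans (Formula.subst_id A)

theorem Term.rename_id {Γ : Ctx} {σ : Ty} (t : Term Γ σ) : t.rename (fun _ x => x) = t :=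
  (Term.rename_eq_subst t _).trans (Term.subst_id t)

theorem Formula.up_up {n m k : ℕ} (h : n ≤ m) (h' : m ≤ k) (A : Formula (stage τ n)) :
    (A.rename (up h)).rename (up h') = A.rename (up (h.trans h')) := by
  rw [Formula.rename_rename, HORM.up_up]

theorem Term.up_up {n m k : ℕ} {σ : Ty} (h : n ≤ m) (h' : m ≤ k) (t : Term (stage τ n) σ) :
    (t.rename (up h)).rename (up h') = t.rename (up (h.trans h')) := by
  rw [Term.rename_rename, HORM.up_up]

theorem Formula.wk_up {n m : ℕ} (h : n ≤ m) (A : Formula (stage τ n)) :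
    (A.rename (up h)).wk (τ := τ m) = A.rename (up (Nat.le_succ_of_le h)) := by
  rw [up_succ h, Formula.wk_eq_rename, Formula.rename_rename]
  rfl

/-- A Henkin chain: consistent sets of assumptions that decide every formula at a later stage
and contain a witness for the failure of every universal formula. -/
structure Chain (T : Theory) (τ : ℕ → Ty) where
  H : ∀ n, List (Formula (stage τ n))
  con : ∀ n, Con T (H n)
  wk_mem : ∀ n, ∀ B ∈ H n, B.wk (τ := τ n) ∈ H (n + 1)
  decide : ∀ n (A : Formula (stage τ n)), ∃ k, ∃ h : n ≤ k,
    A.rename (up h) ∈ H k ∨ A.neg.rename (up h) ∈ H k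
  witness : ∀ n σ (A : Formula (σ :: stage τ n)), ∃ k, ∃ h : n ≤ k, ∃ e : τ k = σ,
    (Formula.all σ A).rename (up (Nat.le_succ_of_le h)) ∈ H (k + 1) ∨
    ((e ▸ A : Formula (τ k :: stage τ n)).rename ((up h).lift (τ k))).neg ∈ H (k + 1)

/-- The contexts depend on the types of the added variables, so the sequence `τ` is fixed first and
the formulas over its stages are enumerated afterwards. Each formula must be treated at a stage that
adds a variable of any prescribed type. -/
theorem exists_chain {H₀ : List (Formula [])} (c : Con T H₀) :
    ∃ (τ : ℕ → Ty) (C : Chain T τ), C.H 0 = H₀ := by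
  have : Nonempty Ty := ⟨Ty.nat⟩
  obtain ⟨e₁, he₁⟩ := exists_surjective_nat Ty
  let τ : ℕ → Ty := fun k => e₁ k.unpair.1
  have : Nonempty (Σ n, Formula (stage τ n)) := ⟨⟨0, Formula.falsum⟩⟩
  obtain ⟨e₂, he₂⟩ := exists_surjective_nat (Σ n, Formula (stage τ n))
  let task : ℕ → Σ n, Formula (stage τ n) := fun k => e₂ k.unpair.2.unpair.1
  have hit : ∀ σ (X : Σ n, Formula (stage τ n)), ∃ k, X.1 ≤ k ∧ τ k = σ ∧ task k = X := by
    intro σ X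
    obtain ⟨a, ha⟩ := he₁ σ
    obtain ⟨b, hb⟩ := he₂ X
    -- The last component is read by neither `τ` nor `task`; it only forces the stage to be late
    -- enough for the formula to make sense.
    refine ⟨Nat.pair a (Nat.pair b X.1), ?_, ?_, ?_⟩
    · exact (Nat.right_le_pair _ _).trans (Nat.right_le_pair _ _)
    · simp [τ, ha]
    · simp [task, hb]
  let target : ∀ k, Formula (stage τ k) := fun k =>
    if h : (task k).1 ≤ k then (task k).2.rename (up h) else Formula.falsum
  let next : ∀ k, {H : List (Formula (stage τ k)) // Con T H} →
      {H : List (Formula (stage τ (k + 1))) // Con T H} :=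
    fun k H => ⟨_, (H.2.extend (τ k) (target k)).choose_spec.1⟩
  let chain : ∀ k, {H : List (Formula (stage τ k)) // Con T H} :=
    fun k => Nat.rec ⟨H₀, c⟩ next k
  have spec : ∀ k, (∀ B ∈ (chain k).1, B.wk ∈ (chain (k + 1)).1) ∧
      ((target k).wk ∈ (chain (k + 1)).1 ∨ (target k).neg.wk ∈ (chain (k + 1)).1) ∧
      ∀ B : Formula (τ k :: stage τ k), target k = Formula.all (τ k) B →
        (target k).wk ∈ (chain (k + 1)).1 ∨ B.neg ∈ (chain (k + 1)).1 :=
    fun k => ((chain k).2.extend (τ k) (target k)).choose_spec.2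
  refine ⟨τ, ⟨fun k => (chain k).1, fun k => (chain k).2, fun k => (spec k).1, ?_, ?_⟩, rfl⟩
  · intro n A
    obtain ⟨k, hk, -, ht⟩ := hit Ty.nat ⟨n, A⟩
    have htg : target k = A.rename (up hk) := by
      have : ∀ X : Σ n, Formula (stage τ n), ∀ h : X = ⟨n, A⟩,
          (if h : X.1 ≤ k then X.2.rename (up h) else Formula.falsum) = A.rename (up hk) := by
        rintro _ rfl
        exact dif_pos hk
      exact this _ ht
    refine ⟨k + 1, Nat.le_succ_of_le hk, ?_⟩
    have := (spec k).2.1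
    rw [htg] at this
    rw [← Formula.wk_up hk, ← Formula.wk_up hk]
    exact this
  · intro n σ A
    obtain ⟨k, hk, hσ, ht⟩ := hit σ ⟨n, Formula.all σ A⟩
    have htg : target k = (Formula.all σ A).rename (up hk) := by
      have : ∀ X : Σ n, Formula (stage τ n), ∀ h : X = ⟨n, Formula.all σ A⟩,
          (if h : X.1 ≤ k then X.2.rename (up h) else Formula.falsum) =
            (Formula.all σ A).rename (up hk) := by
        rintro _ rfl
        exact dif_pos hk
      exact this _ ht
    refine ⟨k, hk, hσ, ?_⟩
    have := (spec k).2.2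
    rw [htg] at this
    subst hσ
    rw [← Formula.wk_up hk]
    exact this _ rfl

end Henkin

/-! ## The term structure of a Henkin chain -/

namespace Chain

variable {T : Theory} {τ : ℕ → Ty} (C : Chain T τ)

theorem up_mem {n k : ℕ} (h : n ≤ k) {A : Formula (stage τ n)} (hA : A ∈ C.H n) :
    A.rename (up h) ∈ C.H k := by
  induction h with
  | refl => rwa [up_self, Formula.rename_id]
  | step h ih =>
    rw [show up (τ := τ) (Nat.le.step h) = _ from up_succ h]
    have := C.wk_mem _ _ ih
    rwa [Formula.wk_eq_rename, Formula.rename_rename] at this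

/-- `A` is eventually among the assumptions of the chain. -/
def Tr {n : ℕ} (A : Formula (stage τ n)) : Prop := ∃ k, ∃ h : n ≤ k, A.rename (up h) ∈ C.H k

variable {C}

theorem Tr.of_le {n k : ℕ} {A : Formula (stage τ n)} (h : n ≤ k)
    (hA : A.rename (up h) ∈ C.H k) {m : ℕ} (hm : k ≤ m) :
    A.rename (up (h.trans hm)) ∈ C.H m := by
  rw [← Formula.up_up h hm]
  exact C.up_mem hm hA

theorem tr_rename {n m : ℕ} (h : n ≤ m) (A : Formula (stage τ n)) :
    C.Tr (A.rename (up h)) ↔ C.Tr A := by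
  constructor
  · rintro ⟨k, hk, hA⟩
    rw [Formula.up_up] at hA
    exact ⟨k, _, hA⟩
  · rintro ⟨k, hk, hA⟩
    refine ⟨max k m, le_max_right _ _, ?_⟩
    rw [Formula.up_up]
    exact Tr.of_le hk hA (le_max_left _ _)

/-- The chain decides `A` at some stage `m`; had it chosen the negation, a derivation of `A` at any
stage after `m` would contradict consistency there. All derivations are used at a single stage, so
no weakening lemma for `Derives` is required. -/
theorem tr_of_derives {n : ℕ} {A : Formula (stage τ n)}
    (h : ∀ m, ∀ hm : n ≤ m, ∃ k, ∃ hk : m ≤ k,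
      Derives T (stage τ k) (C.H k) (A.rename (up (hm.trans hk)))) : C.Tr A := by
  obtain ⟨m, hm, hA⟩ := C.decide n A
  obtain ⟨k, hk, d⟩ := h m hm
  rcases hA with hA | hA
  · exact ⟨m, hm, hA⟩
  · exact (C.con k (.impE (.hyp (Tr.of_le hm hA hk)) d)).elim

theorem tr_neg {n : ℕ} {A : Formula (stage τ n)} : C.Tr A.neg ↔ ¬ C.Tr A := by
  constructor
  · rintro ⟨k, hk, h⟩ ⟨m, hm, h'⟩
    exact (C.con (max k m)).not_both (Tr.of_le hm h' (le_max_right _ _))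
      (Tr.of_le hk h (le_max_left _ _))
  · intro h
    obtain ⟨k, hk, h' | h'⟩ := C.decide n A
    · exact (h ⟨k, hk, h'⟩).elim
    · exact ⟨k, hk, h'⟩

theorem not_tr_falsum {n : ℕ} : ¬ C.Tr (Formula.falsum : Formula (stage τ n)) :=
  fun ⟨k, _, h⟩ => C.con k (.hyp h)

theorem tr_imp {n : ℕ} {A B : Formula (stage τ n)} :
    C.Tr (A ⟹ B) ↔ (C.Tr A → C.Tr B) := by
  constructor
  · rintro ⟨k, hk, h⟩ ⟨m, hm, h'⟩
    refine tr_of_derives fun l hl => ⟨max l (max k m), le_max_left _ _, ?_⟩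
    have h₁ := Tr.of_le hk h (m := max l (max k m)) (by omega)
    have h₂ := Tr.of_le hm h' (m := max l (max k m)) (by omega)
    exact .impE (.hyp h₁) (.hyp h₂)
  · intro h
    by_cases hA : C.Tr A
    · obtain ⟨k, hk, hB⟩ := h hA
      refine tr_of_derives fun l hl => ⟨max l k, le_max_left _ _, ?_⟩
      exact .impI (.hyp (List.mem_cons_of_mem _ (Tr.of_le hk hB (le_max_right _ _))))
    · obtain ⟨k, hk, hA⟩ := tr_neg.2 hA
      refine tr_of_derives fun l hl => ⟨max l k, le_max_left _ _, ?_⟩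
      have h₁ := Tr.of_le hk hA (m := max l k) (le_max_right _ _)
      exact .impI (.raa (.impE (.hyp (List.mem_cons_of_mem _ (List.mem_cons_of_mem _ h₁)))
        (.hyp (List.mem_cons_of_mem _ List.mem_cons_self))))

theorem tr_inst {n : ℕ} {σ : Ty} {A : Formula (σ :: stage τ n)}
    (h : C.Tr (Formula.all σ A)) (t : Term (stage τ n) σ) : C.Tr (A.inst t) := by
  obtain ⟨k, hk, h⟩ := h
  refine tr_of_derives fun l hl => ⟨max l k, le_max_left _ _, ?_⟩
  have h₁ := Tr.of_le hk h (m := max l k) (le_max_right _ _)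
  have := Derives.allE (T := T) (t.rename (up (hl.trans (le_max_left l k)))) (.hyp h₁)
  convert this using 1
  simp only [Formula.inst, Formula.rename_subst, Formula.subst_rename]
  congr 1
  funext ρ x
  cases x <;> rfl

theorem _root_.HORM.Formula.inst_rename_lift_subst {Γ Δ Θ : Ctx} {σ : Ty} (A : Formula (σ :: Γ))
    (s : Sub Γ Δ) (r : Ren Δ Θ) (t : Term Θ σ) :
    ((A.subst (s.lift σ)).rename (r.lift σ)).inst t = A.subst (Sub.cons t (s.compRen r)) := by
  rw [Formula.inst, Formula.rename_subst, Formula.subst_subst]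
  congr 1
  funext ρ x
  cases x with
  | here => rfl
  | there x =>
    simp only [Sub.compRen, Sub.comp, Sub.lift, Term.wk_eq_rename, Sub.cons,
      Term.rename_rename, Term.subst_rename]
    exact (Term.rename_eq_subst _ _).symm

theorem exists_not_tr_inst {n : ℕ} {σ : Ty} {A : Formula (σ :: stage τ n)}
    (h : ¬ C.Tr (Formula.all σ A)) : ∃ k, ∃ hk : n ≤ k, ∃ t : Term (stage τ k) σ,
      ¬ C.Tr ((A.rename ((up hk).lift σ)).inst t) := by
  obtain ⟨k, hk, rfl, hw | hw⟩ := C.witness n σ A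
  · exact (h ⟨k + 1, _, hw⟩).elim
  · refine ⟨k + 1, Nat.le_succ_of_le hk, (v0 : Term (τ k :: stage τ k) (τ k)), ?_⟩
    have e : (A.rename (((up hk).comp (Ren.shift (τ k))).lift (τ k))).inst v0 =
        A.rename ((up hk).lift (τ k)) := by
      rw [Formula.inst, Formula.subst_rename, ← Formula.subst_id (A.rename _),
        Formula.subst_rename]
      congr 1
      funext ρ x
      cases x <;> rfl
    rw [up_succ hk]
    have hn : ¬ C.Tr (n := k + 1) (A.rename ((up hk).lift (τ k)) : Formula (τ k :: stage τ k)) :=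
      tr_neg.1 ⟨k + 1, le_refl _, by rw [up_self, Formula.rename_id]; exact hw⟩
    exact (congrArg (fun B => ¬ C.Tr (n := k + 1) B) e).mpr hn

variable (C)

/-- The structure of all terms that occur in the chain. -/
def termStr : Str where
  D σ := Σ n, Term (stage τ n) σ
  ap s t := ⟨max s.1 t.1, s.2.rename (up (le_max_left _ _)) ⬝ₜ t.2.rename (up (le_max_right _ _))⟩
  cst c := ⟨0, Term.const c⟩
  eq s t := C.Tr (s.2.rename (up (le_max_left s.1 t.1)) =ₜ t.2.rename (up (le_max_right s.1 t.1)))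
  lt s t := C.Tr (s.2.rename (up (le_max_left s.1 t.1)) <ₜ t.2.rename (up (le_max_right s.1 t.1)))

variable {C}

/-- The substitution `s` represents the assignment `ρ`. -/
def Represents {Γ : Ctx} {m : ℕ} (s : Sub Γ (stage τ m)) (ρ : C.termStr.Env Γ) : Prop :=
  ∀ σ x, ∃ h : (ρ σ x).1 ≤ m, (ρ σ x).2.rename (up h) = s σ x

theorem Represents.up {Γ : Ctx} {m k : ℕ} {s : Sub Γ (stage τ m)} {ρ : C.termStr.Env Γ}
    (r : Represents s ρ) (h : m ≤ k) : Represents (s.compRen (HORM.up h)) ρ := by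
  intro σ x
  obtain ⟨h', e⟩ := r σ x
  refine ⟨h'.trans h, ?_⟩
  rw [← Term.up_up h' h, e]
  rfl

theorem Represents.cons {Γ : Ctx} {m : ℕ} {s : Sub Γ (stage τ m)} {ρ : C.termStr.Env Γ}
    (r : Represents s ρ) {σ : Ty} (a : C.termStr.D σ) (h : a.1 ≤ m) :
    Represents (Sub.cons (a.2.rename (HORM.up h)) s) (Str.cons a ρ) := by
  intro σ x
  cases x with
  | here => exact ⟨h, rfl⟩
  | there x => exact r _ x

theorem Represents.eval {Γ : Ctx} {m : ℕ} {s : Sub Γ (stage τ m)} {ρ : C.termStr.Env Γ}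
    (r : Represents s ρ) : ∀ {σ : Ty} (t : Term Γ σ),
    ∃ h : (Str.eval ρ t).1 ≤ m, (Str.eval ρ t).2.rename (HORM.up h) = t.subst s
  | _, Term.var x => r _ x
  | _, Term.const _ => ⟨Nat.zero_le _, rfl⟩
  | _, Term.app u t => by
      obtain ⟨h₁, e₁⟩ := r.eval u
      obtain ⟨h₂, e₂⟩ := r.eval t
      refine ⟨max_le h₁ h₂, ?_⟩
      rw [Term.subst, ← e₁, ← e₂]
      exact congrArg₂ Term.app (Term.up_up _ _ _) (Term.up_up _ _ _)

theorem Represents.exists {Γ : Ctx} (ρ : C.termStr.Env Γ) :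
    ∃ (m : ℕ) (s : Sub Γ (stage τ m)), Represents s ρ := by
  induction Γ with
  | nil => exact ⟨0, fun _ x => (nomatch x), fun _ x => (nomatch x)⟩
  | cons σ Γ ih =>
    obtain ⟨m, s, r⟩ := ih (fun _ x => ρ _ (Var.there x))
    refine ⟨max m (ρ _ Var.here).1,
      Sub.cons ((ρ _ Var.here).2.rename (HORM.up (le_max_right _ _)))
        (s.compRen (HORM.up (le_max_left _ _))), ?_⟩
    convert (r.up (le_max_left m (ρ _ Var.here).1)).cons (ρ _ Var.here) (le_max_right _ _) using 1
    funext σ x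
    cases x <;> rfl

/-- The truth lemma. Elements of the structure live at different stages; `Represents` brings the
values of an assignment to one common stage, where they form a substitution. The universal case uses
the Henkin witnesses in one direction and instantiation in the other. -/
theorem sat_termStr : ∀ {Γ : Ctx} (A : Formula Γ) {m : ℕ} {s : Sub Γ (stage τ m)}
    {ρ : C.termStr.Env Γ}, Represents s ρ → (Str.sat ρ A ↔ C.Tr (A.subst s))
  | _, Formula.eq t u, m, s, ρ, r => by
      obtain ⟨h₁, e₁⟩ := r.eval t
      obtain ⟨h₂, e₂⟩ := r.eval u
      rw [Formula.subst, ← e₁, ← e₂]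
      refine (tr_rename (max_le h₁ h₂) _).symm.trans ?_
      simp only [Formula.rename, Term.up_up]
  | _, Formula.lt t u, m, s, ρ, r => by
      obtain ⟨h₁, e₁⟩ := r.eval t
      obtain ⟨h₂, e₂⟩ := r.eval u
      rw [Formula.subst, ← e₁, ← e₂]
      refine (tr_rename (max_le h₁ h₂) _).symm.trans ?_
      simp only [Formula.rename, Term.up_up]
  | _, Formula.falsum, _, _, _, _ => ⟨False.elim, not_tr_falsum⟩
  | _, Formula.imp A B, _, _, _, r => by
      rw [Formula.subst, tr_imp, Str.sat_imp, sat_termStr A r, sat_termStr B r]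
  | _, Formula.all σ A, m, s, ρ, r => by
      constructor
      · intro h
        by_contra hn
        obtain ⟨k, hk, t, ht⟩ := exists_not_tr_inst hn
        have ra := (r.up hk).cons (⟨k, t⟩ : C.termStr.D σ) (le_refl k)
        have := (sat_termStr A ra).1 (h ⟨k, t⟩)
        rw [up_self, Term.rename_id] at this
        exact ht (by rwa [Formula.inst_rename_lift_subst])
      · intro h a
        have hm := le_max_left m a.1
        have ra := (r.up hm).cons a (le_max_right _ _)
        refine (sat_termStr A ra).2 ?_
        rw [← Formula.inst_rename_lift_subst]
        exact tr_inst ((tr_rename hm _).2 h) _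

theorem termStr_models (hT : ∀ {Γ Δ : Ctx} {A : Formula Γ}, T Γ A → ∀ s : Sub Γ Δ,
    T Δ (A.subst s)) : C.termStr.Models T := by
  intro Γ A ρ hA
  obtain ⟨m, s, r⟩ := Represents.exists ρ
  rw [sat_termStr A r]
  refine tr_of_derives fun k hk => ⟨k, le_refl _, .ax ?_⟩
  rw [Formula.rename_subst]
  exact hT hA _

end Chain

/-- Completeness, for theories that are closed under substitution. -/
theorem proves_of_models {T : Theory}
    (hT : ∀ {Γ Δ : Ctx} {A : Formula Γ}, T Γ A → ∀ s : Sub Γ Δ, T Δ (A.subst s))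
    {B : Formula []} (h : ∀ M : Str, M.Models T → Str.sat (M := M) Str.nil B) :
    Proves T B := by
  by_contra hB
  have c : Con T [B.neg] := fun d => hB (.raa d)
  obtain ⟨τ, C, hC⟩ := exists_chain c
  have hs := h C.termStr (Chain.termStr_models hT)
  have r : Chain.Represents (C := C) (m := 0) (Sub.id []) Str.nil := fun _ x => nomatch x
  have hB : C.Tr (n := 0) B := (congrArg (fun A => C.Tr (n := 0) A) (Formula.subst_id B)).mp
    ((Chain.sat_termStr B r).1 hs)
  refine Chain.tr_neg.1 ⟨0, le_refl _, ?_⟩ hB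
  rw [up_self, Formula.rename_id, hC]
  exact List.mem_cons_self


/-! ## Extensional collapse -/

namespace Str

variable {M : Str}

variable (M) in
/-- Extensional equality, as expressed by `eqAt`. -/
def eqv : (τ : Ty) → M.D τ → M.D τ → Prop
  | Ty.nat, a, b => M.eq a b
  | Ty.arr σ τ, a, b => ∀ z : M.D σ, eqv τ (M.ap a z) (M.ap b z)

@[simp] theorem sat_eqAt : ∀ {Γ : Ctx} (τ : Ty) (ρ : M.Env Γ) (s t : Term Γ τ),
    sat ρ (eqAt τ s t) ↔ M.eqv τ (eval ρ s) (eval ρ t)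
  | _, Ty.nat, _, _, _ => Iff.rfl
  | _, Ty.arr σ τ, ρ, s, t => by simp [eqAt, eqv, sat_eqAt τ]

section

variable (hM : M.Models RCA0omega)

include hM

theorem eqv_equivalence (τ : Ty) : Equivalence (M.eqv τ) := by
  induction τ with
  | nat =>
    refine ⟨fun a => ?_, fun {a b} => ?_, fun {a b c} => ?_⟩
    · simpa [eqv] using hM [] _ nil (.basic .eq_refl) a
    · simpa [eqv] using hM [] _ nil (.basic .eq_symm) a b
    · simpa [eqv] using hM [] _ nil (.basic .eq_trans) a b c
  | arr σ τ _ ih =>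
    exact ⟨fun a z => ih.refl _, fun h z => ih.symm (h z), fun h h' z => ih.trans (h z) (h' z)⟩

/-- Changing the function is harmless by definition of `eqv`; changing the argument is exactly the
extensionality axiom. -/
theorem eqv_ap {σ τ : Ty} {f g : M.D (Ty.arr σ τ)} {a b : M.D σ} (h : M.eqv _ f g)
    (h' : M.eqv _ a b) : M.eqv τ (M.ap f a) (M.ap g b) := by
  have : M.eqv τ (M.ap g a) (M.ap g b) := by
    simpa using hM [] _ nil (.ext σ τ) a b g (by simpa using h')
  exact (eqv_equivalence hM τ).trans (h a) this

theorem lt_congr {a b c d : M.D Ty.nat} (h : M.eq a b) (h' : M.eq c d) (hl : M.lt a c) :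
    M.lt b d := by
  have := hM [] _ nil (.basic .lt_congr) a b c d
  simp only [sat_imp, sat_eq, sat_lt] at this
  exact this h h' hl

def eqvSetoid (τ : Ty) : Setoid (M.D τ) := ⟨M.eqv τ, eqv_equivalence hM τ⟩

/-- The quotient of a structure by extensional equality. -/
def collapse : Str where
  D τ := Quotient (eqvSetoid hM τ)
  ap := Quotient.map₂ (sa := eqvSetoid hM _) (sb := eqvSetoid hM _) (sc := eqvSetoid hM _) M.ap
    fun _ _ h _ _ h' => eqv_ap hM h h'
  cst c := Quotient.mk (eqvSetoid hM _) (M.cst c)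
  eq a b := a = b
  lt := Quotient.lift₂ M.lt fun _ _ _ _ h h' => propext
    ⟨lt_congr hM h h', lt_congr hM ((eqv_equivalence hM Ty.nat).symm h)
      ((eqv_equivalence hM Ty.nat).symm h')⟩

def Env.collapse {Γ : Ctx} (ρ : M.Env Γ) : (collapse hM).Env Γ :=
  fun _ x => Quotient.mk (eqvSetoid hM _) (ρ _ x)

theorem collapse_cons {Γ : Ctx} {τ : Ty} (a : M.D τ) (ρ : M.Env Γ) :
    Env.collapse hM (cons a ρ) =
      cons (M := Str.collapse hM) (Quotient.mk (eqvSetoid hM _) a) (ρ.collapse hM) := by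
  funext σ x
  cases x <;> rfl

theorem eval_collapse {Γ : Ctx} (ρ : M.Env Γ) : ∀ {σ : Ty} (t : Term Γ σ),
    eval (ρ.collapse hM) t = Quotient.mk (eqvSetoid hM _) (eval ρ t)
  | _, Term.var _ => rfl
  | _, Term.const _ => rfl
  | _, Term.app s t => by
      simp only [eval, eval_collapse ρ s, eval_collapse ρ t]; rfl

theorem sat_collapse : ∀ {Γ : Ctx} (A : Formula Γ) (ρ : M.Env Γ),
    sat (ρ.collapse hM) A ↔ sat ρ A
  | _, Formula.eq s t, ρ => by
      simp only [sat, eval_collapse]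
      exact Quotient.eq (r := eqvSetoid hM Ty.nat)
  | _, Formula.lt s t, ρ => by
      simp only [sat, eval_collapse]
      rfl
  | _, Formula.falsum, _ => Iff.rfl
  | _, Formula.imp A B, ρ => by simp only [sat, sat_collapse A, sat_collapse B]
  | _, Formula.all σ A, ρ => by
      constructor
      · intro h a
        have := h (Quotient.mk (eqvSetoid hM _) a)
        rwa [← collapse_cons, sat_collapse A] at this
      · intro h a
        induction a using Quotient.inductionOn with
        | h a =>
          rw [← collapse_cons, sat_collapse A]
          exact h a

theorem Env.exists_collapse {Γ : Ctx} (ρ : (Str.collapse hM).Env Γ) :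
    ∃ ρ' : M.Env Γ, ρ'.collapse hM = ρ :=
  ⟨fun σ x => (ρ σ x).out, funext fun _ => funext fun _ => Quotient.out_eq _⟩

theorem collapse_models {T : Theory} (hT : M.Models T) : (collapse hM).Models T := by
  intro Γ A ρ hA
  obtain ⟨ρ, rfl⟩ := Env.exists_collapse hM ρ
  exact (sat_collapse hM A ρ).2 (hT Γ A ρ hA)

theorem collapse_ext {σ τ : Ty} (f g : (collapse hM).D (Ty.arr σ τ))
    (h : ∀ x, (collapse hM).ap f x = (collapse hM).ap g x) : f = g := by
  induction f, g using Quotient.inductionOn₂ with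
  | h f g =>
    exact Quotient.sound (s := eqvSetoid hM _) fun z =>
      Quotient.exact (s := eqvSetoid hM _) (h (Quotient.mk (eqvSetoid hM _) z))

end

/-- Models of `RCA₀^ω + QF-AC^{2,0}` in which equality at all types is identity. -/
class IsModel (M : Str) : Prop where
  models : M.Models RCA0omegaQFAC20
  eq_iff : ∀ a b, M.eq a b ↔ a = b
  ext : ∀ {σ τ : Ty} {f g : M.D (Ty.arr σ τ)}, (∀ x, M.ap f x = M.ap g x) → f = g

end Str

theorem proves_of_extensional_models {B : Formula []}
    (h : ∀ M : Str, M.IsModel → Str.sat (M := M) Str.nil B) : Proves RCA0omegaQFAC20 B := by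
  refine proves_of_models (fun hA s => hA.subst s) fun M hM => ?_
  have hR : M.Models RCA0omega := fun Γ A ρ hA => hM Γ A ρ (Or.inl hA)
  have := h (Str.collapse hR) ⟨Str.collapse_models hR hM, fun _ _ => Iff.rfl,
    Str.collapse_ext hR _ _⟩
  rw [← Str.sat_collapse hR]
  convert this using 1
  funext _ x
  cases x


namespace Str

variable {M : Str}

instance {σ τ : Ty} : CoeFun (M.D (Ty.arr σ τ)) (fun _ => M.D σ → M.D τ) := ⟨M.ap⟩

/-! ## Combinatory completeness -/

section Combinators

variable [hM : M.IsModel]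

theorem IsModel.rca : M.Models RCA0omega := fun Γ A ρ hA => hM.models Γ A ρ (Or.inl hA)

theorem eqv_iff (τ : Ty) (a b : M.D τ) : M.eqv τ a b ↔ a = b := by
  induction τ with
  | nat => exact IsModel.eq_iff a b
  | arr σ τ _ ih =>
    simp only [eqv, ih]
    exact ⟨IsModel.ext, fun h x => h ▸ rfl⟩

theorem combPi_ap {σ τ : Ty} (a : M.D σ) (b : M.D τ) : M.cst (Const.combPi σ τ) a b = a := by
  have := IsModel.rca [] _ nil (.combPi σ τ) a b
  simpa [eqv_iff] using this

theorem combSigma_ap {ρ σ τ : Ty} (f : M.D (Ty.arr ρ (Ty.arr σ τ))) (g : M.D (Ty.arr ρ σ))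
    (a : M.D ρ) : M.cst (Const.combSigma ρ σ τ) f g a = f a (g a) := by
  have := IsModel.rca [] _ nil (.combSigma ρ σ τ) f g a
  simpa [eqv_iff] using this

end Combinators

/-! ### Functions given by terms with parameters -/

def Env.v0 {Γ : Ctx} {a : Ty} (ρ : M.Env (a :: Γ)) : M.D a := ρ _ Var.here
def Env.v1 {Γ : Ctx} {a b : Ty} (ρ : M.Env (b :: a :: Γ)) : M.D a := ρ _ (Var.there Var.here)
def Env.v2 {Γ : Ctx} {a b c : Ty} (ρ : M.Env (c :: b :: a :: Γ)) : M.D a :=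
  ρ _ (Var.there (Var.there Var.here))

/-- Functions of an assignment that are given by a term with parameters from `M`. -/
@[fun_prop]
inductive Rep {Γ : Ctx} : {τ : Ty} → (M.Env Γ → M.D τ) → Prop
  | var {τ : Ty} (x : Var Γ τ) : Rep (fun ρ => ρ τ x)
  | const {τ : Ty} (c : M.D τ) : Rep (fun _ => c)
  | app {σ τ : Ty} {f : M.Env Γ → M.D (Ty.arr σ τ)} {g : M.Env Γ → M.D σ} :
      Rep f → Rep g → Rep (fun ρ => f ρ (g ρ))

attribute [fun_prop] Rep.const Rep.app

@[fun_prop] theorem Rep.v0 {Γ : Ctx} {a : Ty} : Rep fun ρ : M.Env (a :: Γ) => ρ.v0 := .var _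
@[fun_prop] theorem Rep.v1 {Γ : Ctx} {a b : Ty} : Rep fun ρ : M.Env (b :: a :: Γ) => ρ.v1 :=
  .var _
@[fun_prop] theorem Rep.v2 {Γ : Ctx} {a b c : Ty} :
    Rep fun ρ : M.Env (c :: b :: a :: Γ) => ρ.v2 := .var _

def Env.tail {Γ : Ctx} {a : Ty} (ρ : M.Env (a :: Γ)) : M.Env Γ := fun _ x => ρ _ (Var.there x)

theorem Rep.tail {Γ : Ctx} {a τ : Ty} {f : M.Env Γ → M.D τ} (h : Rep f) :
    Rep fun ρ : M.Env (a :: Γ) => f ρ.tail := by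
  induction h with
  | var x => exact .var _
  | const c => exact .const c
  | app _ _ ih₁ ih₂ => exact ih₁.app ih₂

section

variable [M.IsModel]

/-- Bracket abstraction: the abstracted variable becomes `ΣΠΠ`, anything else that is atomic gets a
`Π` in front, and an application is abstracted through `Σ`. -/
theorem Rep.exists_lam {Γ : Ctx} {σ τ : Ty} {f : M.Env (σ :: Γ) → M.D τ} (h : Rep f) :
    ∃ g : M.Env Γ → M.D (Ty.arr σ τ), Rep g ∧ ∀ ρ a, g ρ a = f (Str.cons a ρ) := by
  induction h with
  | @var τ x =>
    cases x with
    | here =>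
      refine ⟨fun _ => M.cst (Const.combSigma σ (Ty.arr σ σ) σ) (M.cst (Const.combPi _ _))
        (M.cst (Const.combPi _ _)), .const _, fun ρ a => ?_⟩
      rw [combSigma_ap, combPi_ap]
      rfl
    | there x =>
      exact ⟨fun ρ => M.cst (Const.combPi _ _) (ρ _ x), .app (.const _) (.var x),
        fun ρ a => combPi_ap _ _⟩
  | const c => exact ⟨fun _ => M.cst (Const.combPi _ _) c, .const _, fun _ _ => combPi_ap _ _⟩
  | app _ _ ih₁ ih₂ =>
    obtain ⟨g₁, h₁, e₁⟩ := ih₁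
    obtain ⟨g₂, h₂, e₂⟩ := ih₂
    refine ⟨fun ρ => M.cst (Const.combSigma _ _ _) (g₁ ρ) (g₂ ρ),
      .app (.app (.const _) h₁) h₂, fun ρ a => ?_⟩
    rw [combSigma_ap, e₁, e₂]

theorem Rep.fun1 {a τ : Ty} {f : M.Env [a] → M.D τ} (h : Rep f) :
    ∃ F : M.D (Ty.arr a τ), ∀ x, F x = f (Str.cons x nil) := by
  obtain ⟨g, -, hg⟩ := h.exists_lam
  exact ⟨g nil, fun x => hg _ _⟩

theorem Rep.fun2 {a b τ : Ty} {f : M.Env [b, a] → M.D τ} (h : Rep f) :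
    ∃ F : M.D (Ty.arr a (Ty.arr b τ)), ∀ x y, F x y = f (Str.cons y (Str.cons x nil)) := by
  obtain ⟨g, hg, e⟩ := h.exists_lam
  obtain ⟨F, hF⟩ := hg.fun1
  exact ⟨F, fun x y => by rw [hF, e]⟩

theorem Rep.fun3 {a b c τ : Ty} {f : M.Env [c, b, a] → M.D τ} (h : Rep f) :
    ∃ F : M.D (Ty.arr a (Ty.arr b (Ty.arr c τ))),
      ∀ x y z, F x y z = f (Str.cons z (Str.cons y (Str.cons x nil))) := by
  obtain ⟨g, hg, e⟩ := h.exists_lam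
  obtain ⟨F, hF⟩ := hg.fun2
  exact ⟨F, fun x y z => by rw [hF, e]⟩

end

/-! ## Arithmetic -/

section Arithmetic

instance : Zero (M.D Ty.nat) := ⟨M.cst Const.zero⟩
instance : One (M.D Ty.nat) := ⟨M.cst Const.one⟩
instance : Add (M.D Ty.nat) := ⟨fun a b => M.cst Const.add a b⟩
instance : Mul (M.D Ty.nat) := ⟨fun a b => M.cst Const.mul a b⟩
instance : LT (M.D Ty.nat) := ⟨M.lt⟩
instance : LE (M.D Ty.nat) := ⟨fun a b => a < b ∨ a = b⟩

@[simp] theorem lt_iff_lt (a b : M.D Ty.nat) : M.lt a b ↔ a < b := Iff.rfl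

@[simp] theorem eval_zero {Γ : Ctx} (ρ : M.Env Γ) : eval ρ zero = (0 : M.D Ty.nat) := rfl
@[simp] theorem eval_one {Γ : Ctx} (ρ : M.Env Γ) : eval ρ one = (1 : M.D Ty.nat) := rfl
@[simp] theorem eval_add {Γ : Ctx} (ρ : M.Env Γ) (s t : Term Γ Ty.nat) :
    eval ρ (add s t) = (eval ρ s + eval ρ t : M.D Ty.nat) := rfl
@[simp] theorem eval_mul {Γ : Ctx} (ρ : M.Env Γ) (s t : Term Γ Ty.nat) :
    eval ρ (mul s t) = (eval ρ s * eval ρ t : M.D Ty.nat) := rfl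
@[fun_prop] theorem Rep.add {Γ : Ctx} {f g : M.Env Γ → M.D Ty.nat} (hf : Rep f) (hg : Rep g) :
    Rep fun ρ => f ρ + g ρ := ((Rep.const _).app hf).app hg

@[fun_prop] theorem Rep.mul {Γ : Ctx} {f g : M.Env Γ → M.D Ty.nat} (hf : Rep f) (hg : Rep g) :
    Rep fun ρ => f ρ * g ρ := ((Rep.const _).app hf).app hg

variable [M.IsModel]

@[simp] theorem eq_iff_eq (a b : M.D Ty.nat) : M.eq a b ↔ a = b := IsModel.eq_iff a b

@[simp] theorem sat_le {Γ : Ctx} (ρ : M.Env Γ) (s t : Term Γ Ty.nat) :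
    sat ρ (le s t) ↔ (eval ρ s ≤ eval ρ t : Prop) := by
  simp only [le, sat_or, sat_lt, sat_eq, eq_iff_eq]
  rfl

theorem basic {A : Formula []} (h : BasicAx [] A) : sat (M := M) nil A :=
  IsModel.rca [] _ nil (.basic h)

noncomputable instance : CommSemiring (M.D Ty.nat) where
  add_assoc a b c := by simpa using basic (M := M) .add_assoc a b c
  zero_add a := by
    have h₁ : a + 0 = a := by simpa using basic (M := M) .add_zero a
    have h₂ : a + 0 = 0 + a := by simpa using basic (M := M) .add_comm a 0
    rw [← h₂, h₁]
  add_zero a := by simpa using basic (M := M) .add_zero a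
  add_comm a b := by simpa using basic (M := M) .add_comm a b
  nsmul := nsmulRec
  mul_assoc a b c := by simpa using basic (M := M) .mul_assoc a b c
  mul_comm a b := by simpa using basic (M := M) .mul_comm a b
  mul_one a := by simpa using basic (M := M) .mul_one a
  one_mul a := by
    have h₁ : a * 1 = a := by simpa using basic (M := M) .mul_one a
    have h₂ : a * 1 = 1 * a := by simpa using basic (M := M) .mul_comm a 1
    rw [← h₂, h₁]
  mul_zero a := by simpa using basic (M := M) .mul_zero a
  zero_mul a := by
    have h₁ : a * 0 = 0 := by simpa using basic (M := M) .mul_zero a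
    have h₂ : a * 0 = 0 * a := by simpa using basic (M := M) .mul_comm a 0
    rw [← h₂, h₁]
  left_distrib a b c := by simpa using basic (M := M) .mul_add a b c
  right_distrib a b c := by
    have h₁ : ∀ a b : M.D Ty.nat, a * b = b * a := fun a b => by
      simpa using basic (M := M) .mul_comm a b
    have h₂ : c * (a + b) = c * a + c * b := by simpa using basic (M := M) .mul_add c a b
    rw [h₁ (a + b), h₂, h₁ c a, h₁ c b]

theorem num_lt_irrefl (a : M.D Ty.nat) : ¬ a < a := by
  simpa using basic (M := M) .lt_irrefl a

theorem num_lt_trans {a b c : M.D Ty.nat} (h : a < b) (h' : b < c) : a < c := by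
  have := basic (M := M) .lt_trans a b c
  simp only [sat_imp] at this
  exact this h h'

theorem num_lt_total (a b : M.D Ty.nat) : a < b ∨ a = b ∨ b < a := by
  simpa using basic (M := M) .lt_total a b

noncomputable instance : LinearOrder (M.D Ty.nat) where
  le_refl a := Or.inr rfl
  le_trans a b c h h' := by
    rcases h with h | rfl
    · rcases h' with h' | rfl
      · exact Or.inl (num_lt_trans h h')
      · exact Or.inl h
    · exact h'
  le_antisymm a b h h' := by
    rcases h with h | rfl
    · rcases h' with h' | rfl
      · exact (num_lt_irrefl _ (num_lt_trans h h')).elim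
      · rfl
    · rfl
  le_total a b := by
    rcases num_lt_total a b with h | h | h
    · exact Or.inl (Or.inl h)
    · exact Or.inl (Or.inr h)
    · exact Or.inr (Or.inl h)
  lt_iff_le_not_ge a b := by
    constructor
    · intro h
      refine ⟨Or.inl h, ?_⟩
      rintro (h' | rfl)
      · exact num_lt_irrefl _ (num_lt_trans h h')
      · exact num_lt_irrefl _ h
    · rintro ⟨h | rfl, h'⟩
      · exact h
      · exact (h' (Or.inr rfl)).elim
  toDecidableLE := Classical.decRel _

theorem num_add_lt_add {a b : M.D Ty.nat} (h : a < b) (c : M.D Ty.nat) : a + c < b + c := by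
  have := basic (M := M) .add_lt_add a b c
  simp only [sat_imp] at this
  exact this h

theorem num_mul_lt_mul {a b : M.D Ty.nat} (h : a < b) {c : M.D Ty.nat} (hc : 0 < c) :
    a * c < b * c := by
  have := basic (M := M) .mul_lt_mul a b c
  simp only [sat_imp] at this
  exact this h hc

theorem num_add_le_add {a b : M.D Ty.nat} (h : a ≤ b) (c : M.D Ty.nat) : a + c ≤ b + c := by
  rcases h.lt_or_eq with h | rfl
  · exact (num_add_lt_add h c).le
  · exact le_rfl

theorem num_zero_lt_one : (0 : M.D Ty.nat) < 1 := by
  simpa using basic (M := M) .zero_lt_one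

instance : IsStrictOrderedRing (M.D Ty.nat) where
  add_le_add_left _ _ h c := num_add_le_add h c
  le_of_add_le_add_left a b c h := by
    by_contra hn
    have := num_add_lt_add (not_le.1 hn) a
    rw [add_comm c, add_comm b] at this
    exact this.not_ge h
  zero_le_one := num_zero_lt_one.le
  exists_pair_ne := ⟨0, 1, num_zero_lt_one.ne⟩
  mul_lt_mul_of_pos_left c hc a b h := by
    rw [mul_comm c, mul_comm c]
    exact num_mul_lt_mul h hc
  mul_lt_mul_of_pos_right c hc a b h := num_mul_lt_mul h hc

/-! ### Induction -/

theorem ind {Γ : Ctx} (A : Formula (Ty.nat :: Γ)) (hA : A.QF) (ρ : M.Env Γ)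
    (h₀ : sat (cons (0 : M.D Ty.nat) ρ) A)
    (h₁ : ∀ n : M.D Ty.nat, sat (cons n ρ) A → sat (cons (n + 1) ρ) A) (n : M.D Ty.nat) :
    sat (cons n ρ) A := by
  have := IsModel.rca _ _ ρ (.ind A hA)
  simp only [sat_imp, sat_all, Formula.inst, sat_subst] at this
  refine this ?_ (fun n hn => ?_) n
  · convert h₀ using 1
    funext _ x
    cases x <;> rfl
  · convert h₁ n hn using 1
    funext _ x
    cases x <;> rfl

theorem num_nonneg (n : M.D Ty.nat) : 0 ≤ n := by
  have := ind (M := M) (le zero v0) (by simp [le, Formula.or, Formula.neg, Formula.QF]) nil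
    (by simp) (fun n hn => ?_) n
  · simpa using this
  · simp only [sat_le, eval_zero, eval_var_here] at hn ⊢
    exact hn.trans (le_add_of_nonneg_right zero_le_one)

/-- If `n` were neither zero nor a successor, induction on `m` would give `m ≠ n` for every `m`,
including `n` itself. -/
theorem exists_eq_add_one {n : M.D Ty.nat} (h : n ≠ 0) : ∃ m, n = m + 1 := by
  by_contra! hn
  have := ind (M := M) (v0 =ₜ v1).neg (by simp [Formula.neg, Formula.QF]) (cons n nil)
    (by simpa using h.symm) (fun m _ => by simpa using (hn m).symm) n
  simp at this

end Arithmetic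
end Str
namespace Str

variable {M : Str}

/-- The value of the recursor: the `n`-fold iterate of `f` at `a`. -/
def iter (f : M.D Ty.one) (a n : M.D Ty.nat) : M.D Ty.nat :=
  M.cst (Const.recursor Ty.nat) f a n

@[fun_prop] theorem Rep.iter {Γ : Ctx} {f : M.Env Γ → M.D Ty.one} {a n : M.Env Γ → M.D Ty.nat}
    (hf : Rep f) (ha : Rep a) (hn : Rep n) : Rep fun ρ => Str.iter (f ρ) (a ρ) (n ρ) :=
  (((Rep.const _).app hf).app ha).app hn

def npair (a b : M.D Ty.nat) : M.D Ty.nat := (a + b) * (a + b) + a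

@[fun_prop] theorem Rep.npair {Γ : Ctx} {f g : M.Env Γ → M.D Ty.nat} (hf : Rep f) (hg : Rep g) :
    Rep fun ρ => Str.npair (f ρ) (g ρ) := by
  unfold Str.npair
  fun_prop

variable [M.IsModel]

@[simp] theorem iter_zero (f : M.D Ty.one) (a : M.D Ty.nat) : iter f a 0 = a := by
  simpa [iter] using IsModel.rca [] _ nil .rec_zero f a

@[simp] theorem iter_succ (f : M.D Ty.one) (a n : M.D Ty.nat) :
    iter f a (n + 1) = f (iter f a n) := by
  simpa [iter] using IsModel.rca [] _ nil .rec_succ f a n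

theorem qfac_one {Γ : Ctx} (A : Formula (Ty.nat :: Ty.one :: Γ)) (hA : A.QF) (ρ : M.Env Γ)
    (h : ∀ x : M.D Ty.one, ∃ y : M.D Ty.nat, sat (cons y (cons x ρ)) A) :
    ∃ Y : M.D Ty.two, ∀ x, sat (cons (Y x) (cons x ρ)) A := by
  have := IsModel.rca _ _ ρ (.qfac (.choice A hA))
  simp only [sat_imp, sat_all, sat_ex, sat_subst] at this
  obtain ⟨Y, hY⟩ := this h
  refine ⟨Y, fun x => ?_⟩
  convert hY x using 1
  funext _ x
  rcases x with _ | _ | x <;> rfl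

theorem exists_const (a : M.D Ty.nat) : ∃ f : M.D Ty.one, ∀ x, f x = a :=
  Rep.fun1 (f := fun _ => a) (by fun_prop)

/-! ### Predecessor and truncated subtraction -/

/-- The recursor iterates a function that does not see the counter, so the predecessor is obtained
from choice instead. The axiom selects numbers depending on functions; a number is passed as the
value at 0 of a constant function. -/
theorem exists_pred : ∃ p : M.D Ty.one, p 0 = 0 ∧ ∀ n, p (n + 1) = n := by
  obtain ⟨Y, hY⟩ := qfac_one (M := M)
    (((v1 ⬝ₜ zero =ₜ zero) ⋏ (v0 =ₜ zero)) ⋎ (v1 ⬝ₜ zero =ₜ add v0 one))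
    (by simp [Formula.or, Formula.and, Formula.neg, Formula.QF]) nil (fun x => by
      simp only [sat_or, sat_and, sat_eq, eq_iff_eq, eval_app, eval_var_there, eval_var_here,
        eval_zero, eval_add, eval_one]
      by_cases h : x 0 = 0
      · exact ⟨0, Or.inl ⟨h, rfl⟩⟩
      · obtain ⟨m, hm⟩ := exists_eq_add_one h
        exact ⟨m, Or.inr hm⟩)
  simp only [sat_or, sat_and, sat_eq, eq_iff_eq, eval_app, eval_var_there, eval_var_here,
        eval_zero, eval_add, eval_one] at hY
  obtain ⟨K, hK⟩ := Rep.fun2 (M := M) (f := fun ρ : M.Env [Ty.nat, Ty.nat] => ρ.v1)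
    (by fun_prop)
  replace hK : ∀ a b, K a b = a := hK
  obtain ⟨p, hp⟩ := Rep.fun1 (M := M) (f := fun ρ : M.Env [Ty.nat] => Y (K ρ.v0)) (by fun_prop)
  replace hp : ∀ n, p n = Y (K n) := hp
  refine ⟨p, ?_, fun n => ?_⟩
  · rcases hY (K 0) with h | h
    · rw [hp, h.2]
    · rw [hK] at h
      have := num_nonneg (Y (K 0))
      have := num_zero_lt_one (M := M)
      grind
  · rcases hY (K (n + 1)) with h | h
    · rw [hK] at h
      have := num_nonneg n
      have := num_zero_lt_one (M := M)
      grind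
    · rw [hK] at h
      rw [hp]
      grind

variable (M) in
noncomputable def predFn : M.D Ty.one := exists_pred.choose

@[simp] theorem predFn_zero : M.predFn 0 = 0 := exists_pred.choose_spec.1
@[simp] theorem predFn_succ (n : M.D Ty.nat) : M.predFn (n + 1) = n := exists_pred.choose_spec.2 n

noncomputable instance : _root_.Sub (M.D Ty.nat) := ⟨fun a b => iter M.predFn a b⟩

@[fun_prop] theorem Rep.sub {Γ : Ctx} {f g : M.Env Γ → M.D Ty.nat} (hf : Rep f) (hg : Rep g) :
    Rep fun ρ => f ρ - g ρ := (Rep.const _).iter hf hg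

theorem sub_spec (a b : M.D Ty.nat) : a - b + b = a ∨ (a < b ∧ a - b = 0) := by
  have := ind (M := M) ((add (Term.const (Const.recursor Ty.nat) ⬝ₜ v1 ⬝ₜ v2 ⬝ₜ v0) v0 =ₜ v2) ⋎
      ((v2 <ₜ v0) ⋏ (Term.const (Const.recursor Ty.nat) ⬝ₜ v1 ⬝ₜ v2 ⬝ₜ v0 =ₜ zero)))
    (by simp [Formula.or, Formula.and, Formula.neg, Formula.QF])
    (cons M.predFn (cons a nil)) ?_ ?_ b
  · change iter M.predFn a b + b = a ∨ (a < b ∧ iter M.predFn a b = 0)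
    simpa [iter] using this
  · suffices h : iter M.predFn a 0 + 0 = a by
      refine (sat_or _ _ _).2 (Or.inl ?_)
      simpa [iter] using h
    simp
  · intro n hn
    replace hn : iter M.predFn a n + n = a ∨ (a < n ∧ iter M.predFn a n = 0) := by
      simpa [iter] using hn
    suffices h : iter M.predFn a (n + 1) + (n + 1) = a ∨
        (a < n + 1 ∧ iter M.predFn a (n + 1) = 0) by simpa [iter] using h
    rw [iter_succ]
    by_cases h : iter M.predFn a n = 0
    · rw [h, predFn_zero]
      rw [h] at hn
      have := num_zero_lt_one (M := M)
      right
      grind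
    · obtain ⟨m, hm⟩ := exists_eq_add_one h
      rw [hm, predFn_succ]
      rw [hm] at hn
      have := num_nonneg m
      grind

/-! ### Discreteness -/

/-- The axioms of an ordered semi-ring do not give discreteness. Here the difference `n - m` is
nonzero, hence a successor, so `n` is at least `m + 1`. -/
theorem not_between (m n : M.D Ty.nat) (h : m < n) : ¬ n < m + 1 := by
  rcases sub_spec n m with h' | h'
  · intro hn
    by_cases h0 : n - m = 0
    · rw [h0] at h'
      grind
    · obtain ⟨k, hk⟩ := exists_eq_add_one h0
      rw [hk] at h'
      have := num_nonneg k
      grind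
  · exact (h.not_gt h'.1).elim

theorem num_lt_iff {a b : M.D Ty.nat} : a < b ↔ a + 1 ≤ b := by
  constructor
  · intro h
    exact not_lt.1 (not_between a b h)
  · intro h
    have := num_zero_lt_one (M := M)
    grind

theorem sub_cases (a b : M.D Ty.nat) : (b ≤ a ∧ a - b + b = a) ∨ (a ≤ b ∧ a - b = 0) := by
  rcases sub_spec a b with h | h
  · have := num_nonneg (a - b)
    left
    grind
  · right
    grind

theorem sub_eq_zero_iff {a b : M.D Ty.nat} : a - b = 0 ↔ a ≤ b := by
  have := sub_cases a b
  grind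

/-! ### Decidable predicates -/

/-- Predicates that have a characteristic function. -/
@[fun_prop]
def Dec {Γ : Ctx} (P : M.Env Γ → Prop) : Prop :=
  ∃ f : M.Env Γ → M.D Ty.nat, Rep f ∧ ∀ ρ, f ρ = 0 ↔ P ρ

section

variable {Γ : Ctx} {f g : M.Env Γ → M.D Ty.nat} {P Q : M.Env Γ → Prop}

@[fun_prop] theorem Dec.le (hf : Rep f) (hg : Rep g) : Dec fun ρ => f ρ ≤ g ρ :=
  ⟨fun ρ => f ρ - g ρ, by fun_prop, fun _ => sub_eq_zero_iff⟩

@[fun_prop] theorem Dec.lt (hf : Rep f) (hg : Rep g) : Dec fun ρ => f ρ < g ρ :=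
  ⟨fun ρ => f ρ + 1 - g ρ, by fun_prop, fun _ => sub_eq_zero_iff.trans num_lt_iff.symm⟩

theorem num_add_eq_zero {a b : M.D Ty.nat} : a + b = 0 ↔ a = 0 ∧ b = 0 :=
  add_eq_zero_iff_of_nonneg (num_nonneg a) (num_nonneg b)

theorem one_le_iff {a : M.D Ty.nat} : 1 ≤ a ↔ a ≠ 0 := by
  have h := num_nonneg a
  have h' := num_lt_iff (a := 0) (b := a)
  grind

@[fun_prop] theorem Dec.and (hP : Dec P) (hQ : Dec Q) : Dec fun ρ => P ρ ∧ Q ρ := by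
  obtain ⟨f, hf, ef⟩ := hP
  obtain ⟨g, hg, eg⟩ := hQ
  exact ⟨fun ρ => f ρ + g ρ, by fun_prop, fun ρ => by rw [num_add_eq_zero, ef, eg]⟩

@[fun_prop] theorem Dec.not (hP : Dec P) : Dec fun ρ => ¬ P ρ := by
  obtain ⟨f, hf, ef⟩ := hP
  exact ⟨fun ρ => 1 - f ρ, by fun_prop, fun ρ =>
    (sub_eq_zero_iff.trans one_le_iff).trans (not_congr (ef ρ))⟩

@[fun_prop] theorem Dec.or (hP : Dec P) (hQ : Dec Q) : Dec fun ρ => P ρ ∨ Q ρ := by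
  have := (hP.not.and hQ.not).not
  simpa only [not_and_or, not_not] using this

@[fun_prop] theorem Dec.eq (hf : Rep f) (hg : Rep g) : Dec fun ρ => f ρ = g ρ := by
  have := (Dec.le hf hg).and (Dec.le hg hf)
  simpa only [← le_antisymm_iff] using this

/-- Iterate the constant function with value `g ρ`, starting at `f ρ`, as often as the
characteristic function says: zero steps leave `f ρ`, any positive number of steps gives `g ρ`. -/
theorem Rep.char (hP : Dec P) [∀ ρ, Decidable (P ρ)] (hf : Rep f) (hg : Rep g) :
    Rep fun ρ => if P ρ then f ρ else g ρ := by
  obtain ⟨h, hh, e⟩ := hP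
  have : (fun ρ => if P ρ then f ρ else g ρ) =
      fun ρ => Str.iter (M.cst (Const.combPi Ty.nat Ty.nat) (g ρ)) (f ρ) (h ρ) := by
    funext ρ
    split_ifs with hp
    · rw [(e ρ).2 hp, iter_zero]
    · obtain ⟨m, hm⟩ := exists_eq_add_one (mt (e ρ).1 hp)
      rw [hm, iter_succ, combPi_ap]
  rw [this]
  fun_prop

end

theorem Dec.induction {P : M.D Ty.nat → Prop} (hP : Dec fun ρ : M.Env [Ty.nat] => P ρ.v0)
    (h₀ : P 0) (h₁ : ∀ n, P n → P (n + 1)) (n : M.D Ty.nat) : P n := by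
  obtain ⟨f, hf, e⟩ := hP
  obtain ⟨F, hF⟩ := hf.fun1
  have key : ∀ n, F n = 0 ↔ P n := fun n => by rw [hF]; exact e _
  have := ind (M := M) (v1 ⬝ₜ v0 =ₜ zero) (by simp [Formula.QF]) (cons F nil) (by simpa using (key 0).2 h₀)
    (fun n hn => by simpa using (key _).2 (h₁ n ((key n).1 (by simpa using hn)))) n
  exact (key n).1 (by simpa using this)

/-- Choice from numbers to numbers, obtained from choice on type 1 arguments by coding `n` as a
constant function. -/
theorem Dec.choice {P : M.D Ty.nat → M.D Ty.nat → Prop}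
    (hP : Dec fun ρ : M.Env [Ty.nat, Ty.nat] => P ρ.v1 ρ.v0) (h : ∀ n, ∃ m, P n m) :
    ∃ f : M.D Ty.one, ∀ n, P n (f n) := by
  obtain ⟨f, hf, e⟩ := hP
  obtain ⟨F, hF⟩ := hf.fun2
  have key : ∀ n m, F n m = 0 ↔ P n m := fun n m => by rw [hF]; exact e _
  obtain ⟨Y, hY⟩ := qfac_one (M := M) (v2 ⬝ₜ (v1 ⬝ₜ zero) ⬝ₜ v0 =ₜ zero) (by simp [Formula.QF]) (cons F nil)
    (fun x => by
      obtain ⟨m, hm⟩ := h (x 0)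
      exact ⟨m, by simpa using (key _ _).2 hm⟩)
  replace hY : ∀ x, F (x 0) (Y x) = 0 := fun x => by simpa using hY x
  obtain ⟨y, hy⟩ := Rep.fun1 (M := M)
    (f := fun ρ : M.Env [Ty.nat] => Y (M.cst (Const.combPi Ty.nat Ty.nat) ρ.v0)) (by fun_prop)
  refine ⟨y, fun n => (key _ _).1 ?_⟩
  have := hY (M.cst (Const.combPi Ty.nat Ty.nat) n)
  rw [combPi_ap] at this
  rw [hy]
  exact this

/-! ### Pairing -/

theorem exists_sqrt : ∃ r : M.D Ty.one, ∀ n, r n * r n ≤ n ∧ n < (r n + 1) * (r n + 1) := by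
  refine Dec.choice (P := fun n m => m * m ≤ n ∧ n < (m + 1) * (m + 1)) (by fun_prop) fun n => ?_
  by_contra! h
  -- Without a root, `m * m ≤ n` would propagate to all `m`; it fails at `n + 1`.
  have := Dec.induction (P := fun m => m * m ≤ n) (by fun_prop) (by simpa using num_nonneg n) h
    (n + 1)
  have h₁ := num_nonneg n
  have h₂ := num_nonneg (n * n)
  have h₃ := num_zero_lt_one (M := M)
  have e : (n + 1) * (n + 1) = n * n + n + n + 1 := by ring
  grind

variable (M) in
noncomputable def sqrtFn : M.D Ty.one := exists_sqrt.choose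

noncomputable def nfst (n : M.D Ty.nat) : M.D Ty.nat := n - M.sqrtFn n * M.sqrtFn n

noncomputable def nsnd (n : M.D Ty.nat) : M.D Ty.nat := M.sqrtFn n - nfst n

@[fun_prop] theorem Rep.nfst {Γ : Ctx} {f : M.Env Γ → M.D Ty.nat} (hf : Rep f) :
    Rep fun ρ => Str.nfst (f ρ) := by
  unfold Str.nfst
  fun_prop

@[fun_prop] theorem Rep.nsnd {Γ : Ctx} {f : M.Env Γ → M.D Ty.nat} (hf : Rep f) :
    Rep fun ρ => Str.nsnd (f ρ) := by
  unfold Str.nsnd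
  fun_prop

/-- The code lies between the square of `a + b` and the next square, so its integer root recovers
the sum; `nfst` is then the remainder. -/
theorem sqrtFn_npair (a b : M.D Ty.nat) : M.sqrtFn (npair a b) = a + b := by
  have h := (exists_sqrt (M := M)).choose_spec (npair a b)
  change M.sqrtFn (npair a b) * M.sqrtFn (npair a b) ≤ npair a b ∧
    npair a b < (M.sqrtFn (npair a b) + 1) * (M.sqrtFn (npair a b) + 1) at h
  generalize M.sqrtFn (npair a b) = r at h
  have hb := num_nonneg b
  have ha := num_nonneg a
  have h1 := num_zero_lt_one (M := M)
  have e : (a + b + 1) * (a + b + 1) = npair a b + (a + b + b + 1) := by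
    unfold npair
    ring
  have h₁ : npair a b < (a + b + 1) * (a + b + 1) := by grind
  have h₂ : (a + b) * (a + b) ≤ npair a b := le_add_of_nonneg_right ha
  rcases lt_trichotomy r (a + b) with hr | hr | hr
  · have := mul_self_le_mul_self (num_nonneg _) (num_lt_iff.1 hr)
    grind
  · exact hr
  · have := mul_self_le_mul_self (num_nonneg _) (num_lt_iff.1 hr)
    grind

@[simp] theorem nfst_npair (a b : M.D Ty.nat) : nfst (npair a b) = a := by
  have := sub_cases (npair a b) ((a + b) * (a + b))
  rw [nfst, sqrtFn_npair]
  have ha := num_nonneg a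
  unfold npair at *
  grind

@[simp] theorem nsnd_npair (a b : M.D Ty.nat) : nsnd (npair a b) = b := by
  have := sub_cases (a + b) a
  rw [nsnd, nfst_npair, sqrtFn_npair]
  have hb := num_nonneg b
  grind

/-! ### Primitive recursion and bounded quantifiers -/

/-- The recursor iterates without access to the counter; carrying the pair of counter and value
along restores it. -/
theorem exists_primrec : ∃ R : M.D (Ty.arr (Ty.arr Ty.nat Ty.one) (Ty.arr Ty.nat Ty.one)),
    ∀ f a, R f a 0 = a ∧ ∀ n, R f a (n + 1) = f n (R f a n) := by
  obtain ⟨S, hS⟩ := Rep.fun2 (M := M) (f := fun ρ : M.Env [Ty.nat, Ty.arr Ty.nat Ty.one] =>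
    npair (nfst ρ.v0 + 1) (ρ.v1 (nfst ρ.v0) (nsnd ρ.v0))) (by fun_prop)
  replace hS : ∀ f x, S f x = npair (nfst x + 1) (f (nfst x) (nsnd x)) := hS
  obtain ⟨R, hR⟩ := Rep.fun3 (M := M) (f := fun ρ : M.Env [Ty.nat, Ty.nat, Ty.arr Ty.nat Ty.one] =>
    nsnd (iter (S ρ.v2) (npair 0 ρ.v1) ρ.v0)) (by fun_prop)
  replace hR : ∀ f a n, R f a n = nsnd (iter (S f) (npair 0 a) n) := hR
  refine ⟨R, fun f a => ⟨by rw [hR, iter_zero, nsnd_npair], fun n => ?_⟩⟩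
  have := Dec.induction (P := fun n => nfst (iter (S f) (npair 0 a) n) = n) (by fun_prop)
    (by rw [iter_zero, nfst_npair]) (fun n hn => by rw [iter_succ, hS, nfst_npair, hn]) n
  rw [hR, hR, iter_succ, hS, nsnd_npair, this]

noncomputable def primrec (f : M.D (Ty.arr Ty.nat Ty.one)) (a n : M.D Ty.nat) : M.D Ty.nat :=
  exists_primrec.choose f a n

@[fun_prop] theorem Rep.primrec {Γ : Ctx} {f : M.Env Γ → M.D (Ty.arr Ty.nat Ty.one)}
    {a n : M.Env Γ → M.D Ty.nat} (hf : Rep f) (ha : Rep a) (hn : Rep n) :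
    Rep fun ρ => Str.primrec (f ρ) (a ρ) (n ρ) :=
  (((Rep.const _).app hf).app ha).app hn

@[simp] theorem primrec_zero (f : M.D (Ty.arr Ty.nat Ty.one)) (a : M.D Ty.nat) :
    primrec f a 0 = a := (exists_primrec.choose_spec f a).1

@[simp] theorem primrec_succ (f : M.D (Ty.arr Ty.nat Ty.one)) (a n : M.D Ty.nat) :
    primrec f a (n + 1) = f n (primrec f a n) := (exists_primrec.choose_spec f a).2 n

/-- The sum of the characteristic values below the bound is zero exactly when every summand is. -/
theorem Dec.ball {Γ : Ctx} {P : M.Env (Ty.nat :: Γ) → Prop} (hP : Dec P)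
    {b : M.Env Γ → M.D Ty.nat} (hb : Rep b) :
    Dec fun ρ => ∀ i < b ρ, P (Str.cons i ρ) := by
  obtain ⟨f, hf, e⟩ := hP
  have h₁ : Rep fun ρ : M.Env (Ty.nat :: Ty.nat :: Γ) => ρ.v0 + f ρ.tail := Rep.v0.add hf.tail
  obtain ⟨g, hg, eg⟩ := h₁.exists_lam
  obtain ⟨g', hg', eg'⟩ := hg.exists_lam
  have step : ∀ ρ i s, g' ρ i s = s + f (Str.cons i ρ) := fun ρ i s => by rw [eg', eg]; rfl
  refine ⟨fun ρ => Str.primrec (g' ρ) 0 (b ρ), by fun_prop, fun ρ => ⟨fun h i hi => ?_, fun h => ?_⟩⟩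
  · rw [← e]
    by_contra hn
    have := Dec.induction (P := fun n => n ≤ i ∨ Str.primrec (g' ρ) 0 n ≠ 0) (by fun_prop)
      (Or.inl (num_nonneg i)) (fun n hn' => ?_) (b ρ)
    · grind
    · rw [primrec_succ, step, Ne, num_add_eq_zero]
      rcases hn' with h' | h'
      · rcases h'.lt_or_eq with h' | rfl
        · exact Or.inl (num_lt_iff.1 h')
        · exact Or.inr fun h => hn h.2
      · exact Or.inr fun h => h' h.1
  · have := Dec.induction (P := fun n => b ρ < n ∨ Str.primrec (g' ρ) 0 n = 0) (by fun_prop)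
      (Or.inr (by rw [primrec_zero])) (fun n hn' => ?_) (b ρ)
    · grind
    · rw [primrec_succ, step, num_add_eq_zero, e]
      have h1 := num_zero_lt_one (M := M)
      rcases hn' with h' | h'
      · left
        grind
      · rcases lt_or_ge n (b ρ) with hn | hn
        · exact Or.inr ⟨h', h n hn⟩
        · left
          grind

end Str
namespace Str

variable {M : Str} [M.IsModel]

/-! ## The principles in a model -/

def Agree (f g : M.D Ty.one) (N : M.D Ty.nat) : Prop := ∀ i < N, f i = g i

def IsCont (Y : M.D Ty.two) : Prop :=
  ∀ f : M.D Ty.one, ∃ N : M.D Ty.nat, ∀ g : M.D Ty.one, Agree f g N → Y f = Y g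

def InC (f : M.D Ty.one) : Prop := ∀ i, f i ≤ 1

def IsBar (g h : M.D Ty.one) : Prop := h 0 = 0 ∧ ∀ n, h (n + 1) = npair (h n) (g n) + 1

/-- `N` is a modulus of uniform continuity for `Y` on Cantor space. -/
def IsModulus (Y : M.D Ty.two) (N : M.D Ty.nat) : Prop :=
  ∀ f g : M.D Ty.one, InC f → InC g → Agree f g N → Y f = Y g

variable (M)

def HasMUC : Prop := ∃ Ω : M.D Ty.three, ∀ Y : M.D Ty.two, IsModulus Y (Ω Y)

def HasFF : Prop := ∃ Φ : M.D Ty.three, ∀ Y : M.D Ty.two, IsCont Y → IsModulus Y (Φ Y)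

def HasE2 : Prop := ∃ φ : M.D Ty.two, (∀ f, φ f ≤ 1) ∧
  ∀ f : M.D Ty.one, (∃ n, f n = 0) ↔ φ f = 0

def HasS2 : Prop := ∃ S : M.D Ty.two, (∀ f, S f ≤ 1) ∧
  ∀ f : M.D Ty.one, (∃ g h, IsBar g h ∧ ∀ n, f (h n) = 0) ↔ S f = 0

def HasE3 : Prop := ∃ E : M.D Ty.three, (∀ Y, E Y ≤ 1) ∧
  ∀ Y : M.D Ty.two, (∃ f, Y f = 0) ↔ E Y = 0

def HasZ3 : Prop := ∃ Z : M.D Ty.three, ∀ Y : M.D Ty.two, Z Y = 0 ↔ IsCont Y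

theorem sat_MUC : sat (M := M) nil MUC ↔ M.HasMUC := by
  simp [MUC, HasMUC, IsModulus, agree, inC, InC, Agree, leOne]

theorem sat_FF : sat (M := M) nil FF ↔ M.HasFF := by
  simp [FF, HasFF, IsModulus, agree, inC, InC, Agree, leOne, cont, IsCont]

theorem sat_Exists2 : sat (M := M) nil Exists2 ↔ M.HasE2 := by
  simp [Exists2, HasE2, leOne]

theorem sat_Suslin2 : sat (M := M) nil Suslin2 ↔ M.HasS2 := by
  simp [Suslin2, HasS2, leOne, isBar, IsBar, pair, npair]

theorem sat_Exists3 : sat (M := M) nil Exists3 ↔ M.HasE3 := by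
  simp [Exists3, HasE3, leOne]

theorem sat_Z3 : sat (M := M) nil Z3 ↔ M.HasZ3 := by
  simp [Z3, HasZ3, cont, IsCont, agree, Agree]

variable {M}

/-! ## Continuity without `(∃²)` -/

@[fun_prop] theorem Dec.agree {Γ : Ctx} {f g : M.Env Γ → M.D Ty.one} {N : M.Env Γ → M.D Ty.nat}
    (hf : Rep f) (hg : Rep g) (hN : Rep N) : Dec fun ρ => Agree (f ρ) (g ρ) (N ρ) :=
  Dec.ball (P := fun ρ => f ρ.tail ρ.v0 = g ρ.tail ρ.v0)
    (.eq (hf.tail.app .v0) (hg.tail.app .v0)) hN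

theorem exists_fun {f : M.D Ty.nat → M.D Ty.nat} (h : Rep fun ρ : M.Env [Ty.nat] => f ρ.v0) :
    ∃ F : M.D Ty.one, ∀ x, F x = f x := h.fun1

/-- There is a dense sequence in Baire space. -/
theorem exists_dense : ∃ d : M.D (Ty.arr Ty.nat Ty.one),
    ∀ (g : M.D Ty.one) (n : M.D Ty.nat), ∃ s, Agree (d s) g n := by
  obtain ⟨tl, htl⟩ := exists_fun (M := M) (f := fun n => nsnd n) (by fun_prop)
  -- A number is read as an infinite nested list: drop `i` heads, then take the next one.
  obtain ⟨d, hd⟩ := Rep.fun2 (M := M) (f := fun ρ : M.Env [Ty.nat, Ty.nat] =>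
    nfst (iter tl ρ.v1 ρ.v0)) (by fun_prop)
  replace hd : ∀ s i, d s i = nfst (iter tl s i) := hd
  refine ⟨d, fun g n => ?_⟩
  -- The list is built from its end: after `k` steps it holds `g (n - k), …, g (n - 1)`, so after
  -- `n` steps dropping `i` heads returns to step `n - i`.
  obtain ⟨F, hF⟩ := Rep.fun2 (M := M) (f := fun ρ : M.Env [Ty.nat, Ty.nat] =>
    npair (g (n - (ρ.v1 + 1))) ρ.v0) (by fun_prop)
  replace hF : ∀ k a, F k a = npair (g (n - (k + 1))) a := hF
  have h1 := num_zero_lt_one (M := M)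
  have key := Dec.induction
    (P := fun i => n < i ∨ iter tl (primrec F 0 n) i = primrec F 0 (n - i)) (by fun_prop)
    (Or.inr (by
      have := sub_cases n 0
      have := num_nonneg n
      rw [iter_zero, show n - 0 = n by grind]))
    (fun i hi => by
      rcases lt_or_ge n (i + 1) with h | h
      · exact Or.inl h
      · right
        rcases hi with hi | hi
        · grind
        · have e : n - i = n - (i + 1) + 1 := by
            have := sub_cases n i
            have := sub_cases n (i + 1)
            grind
          rw [iter_succ, hi, htl, e, primrec_succ, hF, nsnd_npair])
  refine ⟨primrec F 0 n, fun i hi => ?_⟩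
  have e : n - i = n - (i + 1) + 1 := by
    have := sub_cases n i
    have := sub_cases n (i + 1)
    have := num_lt_iff.1 hi
    grind
  rw [hd, (key i).resolve_left hi.not_gt, e, primrec_succ, hF, nfst_npair, ← e]
  congr 1
  have := sub_cases n i
  have := sub_cases n (n - i)
  have := num_nonneg i
  grind

/-- Grilliot's trick. -/
theorem hasE2_of_sequentially_discontinuous {Y : M.D Ty.two} {f : M.D Ty.one}
    {G : M.D (Ty.arr Ty.nat Ty.one)} (hG : ∀ n, Agree f (G n) n ∧ Y f ≠ Y (G n)) : M.HasE2 := by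
  classical
  have h1 := num_zero_lt_one (M := M)
  -- The search walks upwards from 0 and stops at a zero of `h`. The value of `J h` at `i` needs
  -- only `i` steps: if the least zero `m` exceeds `i`, then `G m` and `f` agree at `i` anyway.
  obtain ⟨s, hs⟩ := Rep.fun2 (M := M) (f := fun ρ : M.Env [Ty.nat, Ty.one] =>
    if ρ.v1 ρ.v0 = 0 then ρ.v0 else ρ.v0 + 1) (.char (by fun_prop) (by fun_prop) (by fun_prop))
  replace hs : ∀ h n, s h n = if h n = 0 then n else n + 1 := hs
  -- `iter (s h) 0 i` is the least zero of `h` below `i`, or else `i`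
  obtain ⟨J, hJ⟩ := Rep.fun2 (M := M) (f := fun ρ : M.Env [Ty.nat, Ty.one] =>
    if ρ.v1 (iter (s ρ.v1) 0 ρ.v0) = 0 then G (iter (s ρ.v1) 0 ρ.v0) ρ.v0 else f ρ.v0)
    (.char (by fun_prop) (by fun_prop) (by fun_prop))
  replace hJ : ∀ h i, J h i =
    if h (iter (s h) 0 i) = 0 then G (iter (s h) 0 i) i else f i := hJ
  have run : ∀ (h : M.D Ty.one) i, h (iter (s h) 0 i) ≠ 0 → iter (s h) 0 i = i := fun h i hi => by
    have := Dec.induction (P := fun i => h (iter (s h) 0 i) = 0 ∨ iter (s h) 0 i = i)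
      (by fun_prop) (Or.inr (iter_zero _ _)) (fun i hi => by
        rw [iter_succ, hs]
        grind) i
    exact this.resolve_left hi
  have settled : ∀ (h : M.D Ty.one) m j, h (iter (s h) 0 m) = 0 → m ≤ j →
      iter (s h) 0 j = iter (s h) 0 m := fun h m j hm hj => by
    have := Dec.induction (P := fun j => j < m ∨ iter (s h) 0 j = iter (s h) 0 m)
      (by fun_prop) (by
        rcases (num_nonneg m).lt_or_eq with h | rfl
        · exact Or.inl h
        · exact Or.inr rfl) (fun j hj => by
        rcases hj with hj | hj
        · rcases (num_lt_iff.1 hj).lt_or_eq with h' | h'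
          · exact Or.inl h'
          · exact Or.inr (by rw [h'])
        · right
          rw [iter_succ, hs, hj, if_pos hm]) j
    exact this.resolve_left hj.not_gt
  obtain ⟨φ, hφ⟩ := Rep.fun1 (M := M) (f := fun ρ : M.Env [Ty.one] =>
    if Y f = Y (J ρ.v0) then 1 else 0) (.char (by fun_prop) (by fun_prop) (by fun_prop))
  replace hφ : ∀ h, φ h = if Y f = Y (J h) then 1 else 0 := hφ
  refine ⟨φ, fun h => ?_, fun h => ⟨?_, fun hh => ?_⟩⟩
  · rw [hφ]
    split_ifs
    · exact le_rfl
    · exact h1.le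
  · rintro ⟨n, hn⟩
    have hz : h (iter (s h) 0 n) = 0 := by
      by_contra hne
      rw [run h n hne] at hne
      exact hne hn
    have e : J h = G (iter (s h) 0 n) := by
      refine IsModel.ext fun i => ?_
      rw [hJ]
      split_ifs with hi
      · congr 2
        rcases le_total n i with hni | hni
        · exact settled h n i hz hni
        · exact (settled h i n hi hni).symm
      -- No zero has been found after `i` steps, so `G` at the least zero agrees with `f` at `i`
      -- provided that this zero exceeds `i`.
      · refine (hG _).1 i ?_
        have e := run h i hi
        rw [e] at hi
        by_contra hlt
        have hni : n < i ∨ i ≤ n := lt_or_ge n i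
        rcases hni with hni | hni
        · have := settled h n i hz hni.le
          grind
        -- The walk never moves back, so the zero reached at stage `n` is at least `i`; it cannot be
        -- `i`, where `h` is nonzero.
        · have : ∀ j, j < i ∨ i ≤ iter (s h) 0 j := Dec.induction (by fun_prop)
            (by
              rcases (num_nonneg i).lt_or_eq with h | rfl
              · exact Or.inl h
              · exact Or.inr (num_nonneg _)) (fun j hj => by
              rcases hj with hj | hj
              · rcases (num_lt_iff.1 hj).lt_or_eq with h' | h'
                · exact Or.inl h'
                · right
                  rw [h', e]
              · right
                rw [iter_succ, hs]
                split_ifs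
                · exact hj
                · grind)
          have := (this n).resolve_left hni.not_gt
          grind
    rw [hφ, e, if_neg (hG _).2]
  · by_contra! hn
    have : J h = f := IsModel.ext fun i => by rw [hJ, if_neg (hn _)]
    rw [hφ, this, if_pos rfl] at hh
    exact h1.ne' hh

/-- Grilliot's trick needs a sequence of functions, but only numbers can be chosen. The
counterexamples are therefore sought among the members of a dense sequence, which are indexed by
numbers. -/
theorem hasE2_of_not_isCont {Y : M.D Ty.two} (hY : ¬ IsCont Y) : M.HasE2 := by
  obtain ⟨d, hd⟩ := exists_dense (M := M)
  simp only [IsCont, not_forall, not_exists, exists_prop] at hY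
  obtain ⟨f, hf⟩ := hY
  by_cases hA : ∀ N, ∃ s, Agree f (d s) N ∧ Y f ≠ Y (d s)
  · obtain ⟨s, hs⟩ := Dec.choice (by fun_prop) hA
    obtain ⟨G, hG⟩ := Rep.fun1 (M := M) (f := fun ρ : M.Env [Ty.nat] => d (s ρ.v0)) (by fun_prop)
    replace hG : ∀ n, G n = d (s n) := hG
    exact hasE2_of_sequentially_discontinuous (f := f) (G := G) fun n => by
      rw [hG]
      exact hs n
  -- Near `f`, all members of the dense sequence share the value `Y f`, yet some nearby `g` does
  -- not. The discontinuity then occurs at `g`: the members converging to `g` are eventually near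
  -- `f`. The shift by `N` makes this hold from index 0 on.
  · push Not at hA
    obtain ⟨N, hN⟩ := hA
    obtain ⟨g, hg, hne⟩ := hf N
    obtain ⟨s, hs⟩ := Dec.choice (P := fun n s => Agree (d s) g n) (by fun_prop) (hd g)
    obtain ⟨G, hG⟩ := Rep.fun1 (M := M) (f := fun ρ : M.Env [Ty.nat] => d (s (ρ.v0 + N)))
      (by fun_prop)
    replace hG : ∀ n, G n = d (s (n + N)) := hG
    refine hasE2_of_sequentially_discontinuous (Y := Y) (f := g) (G := G) fun n => ?_
    have h₁ := hs (n + N)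
    have hn := num_nonneg n
    have hN0 := num_nonneg N
    rw [hG]
    refine ⟨fun i hi => (h₁ i (by grind)).symm, ?_⟩
    rw [← hN (s (n + N)) fun i hi => by rw [hg i hi, h₁ i (by grind)]]
    exact Ne.symm hne

/-- The constant function 1 and the function that drops to 0 only at `Ω φ` agree below the supposed
modulus of `φ`, but only the second has a zero. -/
theorem not_hasE2_of_hasMUC (h : M.HasMUC) : ¬ M.HasE2 := by
  classical
  rintro ⟨φ, -, hφ⟩
  obtain ⟨Ω, hΩ⟩ := h
  have h1 := num_zero_lt_one (M := M)
  obtain ⟨f, hf⟩ := exists_const (M := M) 1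
  obtain ⟨g, hg⟩ := exists_fun (M := M) (f := fun n => if n = Ω φ then 0 else 1)
    (.char (by fun_prop) (by fun_prop) (by fun_prop))
  have := hΩ φ f g (fun i => (hf i).le) (fun i => by
      rw [hg]
      split_ifs
      · exact h1.le
      · exact le_rfl)
    (fun i hi => by rw [hf, hg, if_neg hi.ne])
  rw [(hφ g).1 ⟨Ω φ, by rw [hg, if_pos rfl]⟩] at this
  obtain ⟨n, hn⟩ := (hφ f).2 this
  rw [hf] at hn
  exact h1.ne' hn

theorem hasMUC_iff : M.HasMUC ↔ M.HasFF ∧ ¬ M.HasE2 := by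
  refine ⟨fun h => ⟨?_, not_hasE2_of_hasMUC h⟩, ?_⟩
  · obtain ⟨Ω, hΩ⟩ := h
    exact ⟨Ω, fun Y _ => hΩ Y⟩
  · rintro ⟨⟨Φ, hΦ⟩, h⟩
    exact ⟨Φ, fun Y => hΦ Y (not_not.1 fun hY => h (hasE2_of_not_isCont hY))⟩

theorem hasZ3_of_not_hasE2 (h : ¬ M.HasE2) : M.HasZ3 := by
  obtain ⟨Z, hZ⟩ := Rep.fun1 (M := M) (f := fun _ : M.Env [Ty.two] => (0 : M.D Ty.nat))
    (by fun_prop)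
  exact ⟨Z, fun Y => iff_of_true (hZ Y) (not_not.1 fun hY => h (hasE2_of_not_isCont hY))⟩

/-! ## Strength of the comprehension functionals -/

theorem exists_bar : ∃ b : M.D (Ty.arr Ty.one Ty.one), ∀ g, IsBar g (b g) := by
  obtain ⟨F, hF⟩ := Rep.fun3 (M := M) (f := fun ρ : M.Env [Ty.nat, Ty.nat, Ty.one] =>
    npair ρ.v0 (ρ.v2 ρ.v1) + 1) (by fun_prop)
  replace hF : ∀ g n a, F g n a = npair a (g n) + 1 := hF
  obtain ⟨b, hb⟩ := Rep.fun2 (M := M) (f := fun ρ : M.Env [Ty.nat, Ty.one] =>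
    primrec (F ρ.v1) 0 ρ.v0) (by fun_prop)
  replace hb : ∀ g n, b g n = primrec (F g) 0 n := hb
  exact ⟨b, fun g => ⟨by rw [hb, primrec_zero], fun n => by rw [hb, hb, primrec_succ, hF]⟩⟩

theorem IsBar.unique {g h h' : M.D Ty.one} (hh : IsBar g h) (hh' : IsBar g h') : h = h' :=
  IsModel.ext (Dec.induction (by fun_prop) (by rw [hh.1, hh'.1])
    fun n hn => by rw [hh.2, hh'.2, hn])

/-- A number is tested through the tree of sequences all of whose entries are zeros of `f`: it has
an infinite branch exactly when `f` has a zero, namely a constant one. -/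
theorem hasE2_of_hasS2 (h : M.HasS2) : M.HasE2 := by
  classical
  obtain ⟨S, hS, hS'⟩ := h
  obtain ⟨b, hb⟩ := exists_bar (M := M)
  -- A nonempty sequence has code `npair c a + 1`, so `nsnd` of the predecessor is its last entry;
  -- the empty sequence, with code 0, is accepted outright.
  obtain ⟨F, hF⟩ := Rep.fun2 (M := M) (f := fun ρ : M.Env [Ty.nat, Ty.one] =>
    if ρ.v0 = 0 then 0 else ρ.v1 (nsnd (M.predFn ρ.v0)))
    (.char (by fun_prop) (by fun_prop) (by fun_prop))
  replace hF : ∀ f c, F f c = if c = 0 then 0 else f (nsnd (M.predFn c)) := hF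
  have hF1 : ∀ f c, F f (c + 1) = f (nsnd c) := fun f c => by
    have := num_nonneg c
    have := num_zero_lt_one (M := M)
    rw [hF, if_neg (by grind), predFn_succ]
  obtain ⟨φ, hφ⟩ := Rep.fun1 (M := M) (f := fun ρ : M.Env [Ty.one] => S (F ρ.v0)) (by fun_prop)
  replace hφ : ∀ f, φ f = S (F f) := hφ
  refine ⟨φ, fun f => by rw [hφ]; exact hS _, fun f => ?_⟩
  rw [hφ, ← hS']
  constructor
  · rintro ⟨n, hn⟩
    obtain ⟨g, hg⟩ := exists_const n
    refine ⟨g, b g, hb g, fun k => ?_⟩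
    by_cases hk : k = 0
    · rw [hk, (hb g).1, hF, if_pos rfl]
    · obtain ⟨k, rfl⟩ := exists_eq_add_one hk
      rw [(hb g).2, hF1, nsnd_npair, hg, hn]
  · rintro ⟨g, h, hh, hz⟩
    refine ⟨g 0, ?_⟩
    have := hz (0 + 1)
    rwa [hh.2, hF1, nsnd_npair] at this

/-- Searching for a number is searching for a function through its value at 0. -/
theorem hasE2_of_hasE3 (h : M.HasE3) : M.HasE2 := by
  obtain ⟨E, hE, hE'⟩ := h
  obtain ⟨F, hF⟩ := Rep.fun2 (M := M) (f := fun ρ : M.Env [Ty.one, Ty.one] => ρ.v1 (ρ.v0 0))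
    (by fun_prop)
  replace hF : ∀ f g, F f g = f (g 0) := hF
  obtain ⟨φ, hφ⟩ := Rep.fun1 (M := M) (f := fun ρ : M.Env [Ty.one] => E (F ρ.v0)) (by fun_prop)
  replace hφ : ∀ f, φ f = E (F f) := hφ
  refine ⟨φ, fun f => by rw [hφ]; exact hE _, fun f => ?_⟩
  rw [hφ, ← hE']
  constructor
  · rintro ⟨n, hn⟩
    obtain ⟨g, hg⟩ := exists_const n
    exact ⟨g, by rw [hF, hg, hn]⟩
  · rintro ⟨g, hg⟩
    exact ⟨g 0, by rw [← hF, hg]⟩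

/-- `(∃²)`, itself a consequence of `(∃³)`, decides the inner number quantifier; `(∃³)` then handles
the function quantifier. The codes of initial segments are unique, so the bar function may be taken
to be `b g`. -/
theorem hasS2_of_hasE3 (h : M.HasE3) : M.HasS2 := by
  obtain ⟨φ, -, hφ⟩ := hasE2_of_hasE3 h
  obtain ⟨E, hE, hE'⟩ := h
  obtain ⟨b, hb⟩ := exists_bar (M := M)
  obtain ⟨U, hU⟩ := Rep.fun3 (M := M) (f := fun ρ : M.Env [Ty.nat, Ty.one, Ty.one] =>
    1 - ρ.v2 (b ρ.v1 ρ.v0)) (by fun_prop)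
  replace hU : ∀ f g n, U f g n = 1 - f (b g n) := hU
  obtain ⟨W, hW⟩ := Rep.fun2 (M := M) (f := fun ρ : M.Env [Ty.one, Ty.one] =>
    1 - φ (U ρ.v1 ρ.v0)) (by fun_prop)
  replace hW : ∀ f g, W f g = 1 - φ (U f g) := hW
  have key : ∀ f g, W f g = 0 ↔ ∀ n, f (b g n) = 0 := fun f g => by
    rw [hW, sub_eq_zero_iff, one_le_iff, Ne, ← hφ]
    simp only [hU, sub_eq_zero_iff, one_le_iff, not_exists, not_not]
  obtain ⟨S, hS⟩ := Rep.fun1 (M := M) (f := fun ρ : M.Env [Ty.one] => E (W ρ.v0)) (by fun_prop)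
  replace hS : ∀ f, S f = E (W f) := hS
  refine ⟨S, fun f => by rw [hS]; exact hE _, fun f => ?_⟩
  rw [hS, ← hE']
  simp only [key]
  constructor
  · rintro ⟨g, h, hh, hz⟩
    exact ⟨g, by rwa [(hb g).unique hh]⟩
  · rintro ⟨g, hz⟩
    exact ⟨g, b g, hb g, hz⟩

/-- A function `u` codes a pair of functions. `W Y` takes the value 1 at `u` when the first is a
zero of `Y` and the second vanishes identically, which `(∃²)` decides, and 0 otherwise. A zero of
`Y` makes `W Y` discontinuous, and without zeros `W Y` is constant; `(Z³)` tells which. -/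
theorem hasE3_of_hasE2_of_hasZ3 (h : M.HasE2) (h' : M.HasZ3) : M.HasE3 := by
  classical
  obtain ⟨φ, -, hφ⟩ := h
  obtain ⟨Z, hZ⟩ := h'
  have h1 := num_zero_lt_one (M := M)
  obtain ⟨L, hL⟩ := Rep.fun2 (M := M) (f := fun ρ : M.Env [Ty.nat, Ty.one] => nfst (ρ.v1 ρ.v0))
    (by fun_prop)
  replace hL : ∀ u n, L u n = nfst (u n) := hL
  obtain ⟨R, hR⟩ := Rep.fun2 (M := M) (f := fun ρ : M.Env [Ty.nat, Ty.one] =>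
    1 - nsnd (ρ.v1 ρ.v0)) (by fun_prop)
  replace hR : ∀ u n, R u n = 1 - nsnd (u n) := hR
  have hφR : ∀ u, φ (R u) ≠ 0 ↔ ∀ n, nsnd (u n) = 0 := fun u => by
    rw [Ne, ← hφ]
    simp only [hR, sub_eq_zero_iff, one_le_iff, not_exists, not_not]
  obtain ⟨W, hW⟩ := Rep.fun2 (M := M) (f := fun ρ : M.Env [Ty.one, Ty.two] =>
    if ρ.v1 (L ρ.v0) = 0 ∧ ¬ φ (R ρ.v0) = 0 then 1 else 0)
    (.char (by fun_prop) (by fun_prop) (by fun_prop))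
  replace hW : ∀ Y u, W Y u = if Y (L u) = 0 ∧ ¬ φ (R u) = 0 then 1 else 0 := hW
  have key : ∀ Y, (∃ f, Y f = 0) ↔ ¬ IsCont (W Y) := by
    refine fun Y => ⟨?_, fun hc => ?_⟩
    · rintro ⟨f, hf⟩ hc
      obtain ⟨u, hu⟩ := exists_fun (M := M) (f := fun n => npair (f n) 0) (by fun_prop)
      obtain ⟨N, hN⟩ := hc u
      -- Whatever `N` is proposed at `u`, altering the second function at `N` alone keeps the
      -- agreement below `N` but drops the value of `W Y` from 1 to 0.
      obtain ⟨e, he⟩ := exists_fun (M := M) (f := fun n => if n = N then 1 else 0)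
        (.char (by fun_prop) (by fun_prop) (by fun_prop))
      obtain ⟨w, hw⟩ := exists_fun (M := M) (f := fun n => npair (f n) (e n)) (by fun_prop)
      have := hN w fun i hi => by rw [hu, hw, he, if_neg hi.ne]
      have hLu : L u = f := IsModel.ext fun n => by rw [hL, hu, nfst_npair]
      rw [hW, hW, hLu, if_pos ⟨hf, (hφR u).2 fun n => by rw [hu, nsnd_npair]⟩, if_neg] at this
      · exact h1.ne' this
      · rintro ⟨-, h⟩
        have := (hφR w).1 h N
        rw [hw, nsnd_npair, he, if_pos rfl] at this
        exact h1.ne' this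
    · by_contra! hn
      have : ∀ u, W Y u = 0 := fun u => by rw [hW, if_neg fun h => hn _ h.1]
      exact hc fun f => ⟨0, fun g _ => by rw [this, this]⟩
  obtain ⟨E, hE⟩ := Rep.fun1 (M := M) (f := fun ρ : M.Env [Ty.two] =>
    if Z (W ρ.v0) = 0 then 1 else 0) (.char (by fun_prop) (by fun_prop) (by fun_prop))
  replace hE : ∀ Y, E Y = if Z (W Y) = 0 then 1 else 0 := hE
  refine ⟨E, fun Y => ?_, fun Y => ?_⟩
  · rw [hE]
    split_ifs
    · exact le_rfl
    · exact h1.le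
  · rw [key, ← hZ, hE]
    split_ifs with hz
    · exact iff_of_false (not_not.2 hz) h1.ne'
    · exact iff_of_true hz rfl

end Str
end HORM

/-! ### The three equivalences -/

theorem mainTheorem9 :
    HORM.Proves HORM.RCA0omegaQFAC20
      (HORM.MUC ⟺ (HORM.FF ⋏ HORM.Exists2.neg)) ∧
    HORM.Proves HORM.RCA0omegaQFAC20
      ((HORM.FF ⋏ HORM.Exists2.neg) ⟺ (HORM.FF ⋏ HORM.Z3 ⋏ HORM.Suslin2.neg)) ∧
    HORM.Proves HORM.RCA0omegaQFAC20
      ((HORM.FF ⋏ HORM.Z3 ⋏ HORM.Suslin2.neg) ⟺ (HORM.FF ⋏ HORM.Z3 ⋏ HORM.Exists3.neg)) := by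
  refine ⟨HORM.proves_of_extensional_models fun M _ => ?_,
    HORM.proves_of_extensional_models fun M _ => ?_,
    HORM.proves_of_extensional_models fun M _ => ?_⟩ <;>
  simp only [HORM.Str.sat_iff, HORM.Str.sat_and, HORM.Str.sat_neg, HORM.Str.sat_MUC,
    HORM.Str.sat_FF, HORM.Str.sat_Exists2, HORM.Str.sat_Exists3, HORM.Str.sat_Suslin2,
    HORM.Str.sat_Z3]
  · exact HORM.Str.hasMUC_iff
  · refine and_congr_right fun _ => ⟨fun h => ⟨HORM.Str.hasZ3_of_not_hasE2 h,
      mt HORM.Str.hasE2_of_hasS2 h⟩, fun h h₂ => h.2 ?_⟩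
    exact HORM.Str.hasS2_of_hasE3 (HORM.Str.hasE3_of_hasE2_of_hasZ3 h₂ h.1)
  · refine and_congr_right fun _ => and_congr_right fun hZ => not_congr ⟨fun h => ?_,
      HORM.Str.hasS2_of_hasE3⟩
    exact HORM.Str.hasE3_of_hasE2_of_hasZ3 (HORM.Str.hasE2_of_hasS2 h) hZ
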